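/- Let $\Gamma:\mathbb R\to\mathbb R^2$ be a planar curve parametrized by arc length which is a $C^3$-diffeomorphism of $\mathbb R$ onto its image. Put $N=(-\dot\Gamma_2,\dot\Gamma_1)$ and let $\gamma(s)=-\dot\Gamma(s)\cdot\dot N(s)$ be the signed curvature. Let $d>0$, suppose that there are real numbers $\gamma_-,\gamma_+>0$ with $-\gamma_-\le\gamma(s)\le\gamma_+<1/d$ for all $s\in\mathbb R$, that $\dot\gamma$ is bounded, and that the strip $\Omega=\{\Gamma(s)+uN(s) : s\in\mathbb R,\ 0<u<d\}$ is not self-intersecting, i.e. $(s,u)\mapsto\Gamma(s)+uN(s)$ is injective on $\mathbb R\times(0,d)$. Let $L_\Omega^{DN}$ be the Dirichlet–Neumann Laplacian of the strip (Dirichlet condition on $\{\Gamma(s)\}$, Neumann condition on $\{\Gamma(s)+dN(s)\}$), that is, the operator in $L^2\bigl(\mathbb R\times(0,d),(1-u\gamma(s))\,ds\,du\bigr)$ associated with the quadratic form $$q_0(f,g)=\int_{\mathbb R}ds\int_0^d du\,\Bigl(\frac{1}{1-u\gamma(s)}\,\overline{\frac{\partial f}{\partial s}}\,\frac{\partial g}{\partial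 s}+(1-u\gamma(s))\,\overline{\frac{\partial f}{\partial u}}\,\frac{\partial g}{\partial u}\Bigr)$$ with form domain $Q(q_0)=\{f\in H^1(\mathbb R\times(0,d)) : f(s,0)=0\text{ for a.e. }s\in\mathbb R\}$, where $f(\cdot,0)$ is the trace of $f$ on $\mathbb R\times\{0\}$. In other words, $f$ is in the domain of $L_\Omega^{DN}$ and $L_\Omega^{DN}f=h$ if and only if $f\in Q(q_0)$ and $q_0(g,f)=\langle g,h\rangle$ for all $g\in Q(q_0)$, where $\langle\cdot,\cdot\rangle$ is the inner product of this weighted $L^2$ space. Suppose that there is a real number $s_0>0$ such that $\gamma(s)\le 0$ for every $s$ with $|s|\ge s_0$ and $\int_{-s_0}^{s_0}\gamma(s)\,ds<0$. Then $L_\Omega^{DN}$ is self-adjoint, its spectrum is non-empty and bounded below, and $$\inf\sigma\bigl(L_\Omega^{DN}\bigr)<\frac{\pi^2}{4d^2}.$$ -/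

import Mathlib

open MeasureTheory Set Topology
open scoped ContDiff ENNReal

noncomputable section

/-! ### Weak derivatives, `H¹` and boundary traces on the straight strip -/

/-- The straight strip `ℝ × (0, d)`, with coordinates `(s, u)`. -/
def straightStrip (d : ℝ) : Set (ℝ × ℝ) := univ ×ˢ Ioo 0 d

/-- `g` is the weak derivative of `f` on the open set `U` in the direction `v`. -/
structure HasWeakDeriv (U : Set (ℝ × ℝ)) (v : ℝ × ℝ) (f g : ℝ × ℝ → ℂ) : Prop where
  locInt_fun : LocallyIntegrableOn f U
  locInt_deriv : LocallyIntegrableOn g U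
  integral_eq : ∀ φ : ℝ × ℝ → ℝ, ContDiff ℝ ∞ φ → HasCompactSupport φ → tsupport φ ⊆ U →
    ∫ p in U, fderiv ℝ φ p v • f p = -∫ p in U, φ p • g p

open Classical in
/-- The weak derivative of `f` on `U` in the direction `v` (unique up to null sets), if it exists;
the zero function otherwise. -/
def weakDeriv (U : Set (ℝ × ℝ)) (v : ℝ × ℝ) (f : ℝ × ℝ → ℂ) : ℝ × ℝ → ℂ :=
  if h : ∃ g, HasWeakDeriv U v f g then h.choose else 0

/-- `f` has a weak derivative on `U` in the direction `v` which belongs to `L²(U)`. -/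
def HasL2WeakDeriv (U : Set (ℝ × ℝ)) (v : ℝ × ℝ) (f : ℝ × ℝ → ℂ) : Prop :=
  ∃ g, HasWeakDeriv U v f g ∧ MemLp g 2 (volume.restrict U)

/-- The Sobolev space `H¹(U) = W^{1,2}(U)`: `f` and its weak partial derivatives
`∂f/∂s`, `∂f/∂u` are in `L²(U)`. -/
structure MemH1 (U : Set (ℝ × ℝ)) (f : ℝ × ℝ → ℂ) : Prop where
  memLp : MemLp f 2 (volume.restrict U)
  deriv_s : HasL2WeakDeriv U (1, 0) f
  deriv_u : HasL2WeakDeriv U (0, 1) f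

/-- For `f ∈ H¹(ℝ × (0, d))`: the function `t ∈ L²(ℝ)` is the trace of `f` on the part `ℝ × {0}`
of the boundary. The trace is characterized by the Gauss-Green formula, tested with the smooth
compactly supported functions that vanish near the other boundary line `ℝ × {d}`. -/
structure HasTraceAtZero (d : ℝ) (f : ℝ × ℝ → ℂ) (t : ℝ → ℂ) : Prop where
  memLp : MemLp t 2 volume
  green : ∀ φ : ℝ × ℝ → ℝ, ContDiff ℝ ∞ φ → HasCompactSupport φ → tsupport φ ⊆ {p | p.2 < d} →
    ∫ p in straightStrip d, fderiv ℝ φ p (0, 1) • f p =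
      -(∫ p in straightStrip d, φ p • weakDeriv (straightStrip d) (0, 1) f p)
        - ∫ s : ℝ, φ (s, 0) • t s

/-! ### Curved strips -/

/-- The normal vector `N = (-Γ₂', Γ₁')` of a planar curve parametrized by arc length. -/
def curveNormal (Γ : ℝ → EuclideanSpace ℝ (Fin 2)) (s : ℝ) : EuclideanSpace ℝ (Fin 2) :=
  !₂[-(deriv Γ s 1), deriv Γ s 0]

/-- The signed curvature `γ = -Γ' ⋅ N'` of a planar curve parametrized by arc length. -/
def signedCurvature (Γ : ℝ → EuclideanSpace ℝ (Fin 2)) (s : ℝ) : ℝ :=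
  -inner ℝ (deriv Γ s) (deriv (curveNormal Γ) s)

/-- The standing assumptions on the curve `Γ` and on the width `d` of the curved strip
`{Γ(s) + u N(s) | s ∈ ℝ, 0 < u < d}`. -/
structure IsCurvedStrip (Γ : ℝ → EuclideanSpace ℝ (Fin 2)) (d : ℝ) : Prop where
  d_pos : 0 < d
  contDiff : ContDiff ℝ 3 Γ
  /-- Together with `contDiff` and `unit_speed`: `Γ` is a `C³`-diffeomorphism onto its image. -/
  isEmbedding : IsEmbedding Γ
  unit_speed : ∀ s, (deriv Γ s 0) ^ 2 + (deriv Γ s 1) ^ 2 = 1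
  curvature_bounds : ∃ γm γp : ℝ, 0 < γm ∧ 0 < γp ∧ γp < 1 / d ∧
    ∀ s, -γm ≤ signedCurvature Γ s ∧ signedCurvature Γ s ≤ γp
  deriv_curvature_bounded : ∃ C : ℝ, ∀ s, |deriv (signedCurvature Γ) s| ≤ C
  /-- The strip is not self-intersecting. -/
  not_selfintersecting :
    InjOn (fun p : ℝ × ℝ => Γ p.1 + p.2 • curveNormal Γ p.1) (straightStrip d)

/-- The Jacobian `1 - u γ(s)` of the strip coordinates `(s, u)`. -/
def stripJacobian (Γ : ℝ → EuclideanSpace ℝ (Fin 2)) (p : ℝ × ℝ) : ℝ :=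
  1 - p.2 * signedCurvature Γ p.1

/-- The measure `(1 - u γ(s)) ds du` on `ℝ × (0, d)`. -/
def stripMeasure (Γ : ℝ → EuclideanSpace ℝ (Fin 2)) (d : ℝ) : Measure (ℝ × ℝ) :=
  (volume.restrict (straightStrip d)).withDensity fun p => ENNReal.ofReal (stripJacobian Γ p)

/-- The Hilbert space `L²(ℝ × (0, d), (1 - u γ(s)) ds du)`. -/
abbrev StripL2 (Γ : ℝ → EuclideanSpace ℝ (Fin 2)) (d : ℝ) : Type :=
  Lp ℂ 2 (stripMeasure Γ d)

/-- The domain of the quadratic form: all `f ∈ H¹(ℝ × (0, d))` with `f(s, 0) = 0` for a.e. `s`. -/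
structure MemFormDomain (Γ : ℝ → EuclideanSpace ℝ (Fin 2)) (d : ℝ) (f : StripL2 Γ d) : Prop where
  memH1 : MemH1 (straightStrip d) f
  trace_eq_zero : ∃ t : ℝ → ℂ, HasTraceAtZero d f t ∧ ∀ᵐ s, t s = 0

/-- The integrand of the sesquilinear form. -/
def stripFormIntegrand (Γ : ℝ → EuclideanSpace ℝ (Fin 2)) (d : ℝ) (f g : StripL2 Γ d)
    (p : ℝ × ℝ) : ℂ :=
  ((1 / stripJacobian Γ p : ℝ) : ℂ) *
      (starRingEnd ℂ (weakDeriv (straightStrip d) (1, 0) f p) *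
        weakDeriv (straightStrip d) (1, 0) g p) +
    ((stripJacobian Γ p : ℝ) : ℂ) *
      (starRingEnd ℂ (weakDeriv (straightStrip d) (0, 1) f p) *
        weakDeriv (straightStrip d) (0, 1) g p)

/-- The sesquilinear form
`q₀(f, g) = ∫ ds ∫₀ᵈ du ((1 - uγ)⁻¹ conj(∂f/∂s) ∂g/∂s + (1 - uγ) conj(∂f/∂u) ∂g/∂u)`. -/
def stripForm (Γ : ℝ → EuclideanSpace ℝ (Fin 2)) (d : ℝ) (f g : StripL2 Γ d) : ℂ :=
  ∫ p in straightStrip d, stripFormIntegrand Γ d f g p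

/-! ### Facts that make the operator well defined -/

theorem isOpen_straightStrip (d : ℝ) : IsOpen (straightStrip d) :=
  isOpen_univ.prod isOpen_Ioo

theorem integrable_smul_of_tsupport {U : Set (ℝ × ℝ)} {φ : ℝ × ℝ → ℝ} (hφ : Continuous φ)
    (hc : HasCompactSupport φ) (hs : tsupport φ ⊆ U) {k : ℝ × ℝ → ℂ}
    (hk : LocallyIntegrableOn k U) : Integrable (fun p => φ p • k p) := by
  have hkk : IntegrableOn k (tsupport φ) := hk.integrableOn_compact_subset hs hc
  have h1 : IntegrableOn (fun p => φ p • k p) (tsupport φ) :=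
    hkk.continuousOn_smul hφ.continuousOn hc
  rw [integrableOn_iff_integrable_of_support_subset] at h1
  · exact h1
  · intro p hp
    apply subset_tsupport
    intro h0
    exact hp (by simp [h0])

theorem HasWeakDeriv.ae_eq {U : Set (ℝ × ℝ)} (hU : IsOpen U) {v : ℝ × ℝ} {f g g' : ℝ × ℝ → ℂ}
    (h : HasWeakDeriv U v f g) (h' : HasWeakDeriv U v f g') : g =ᵐ[volume.restrict U] g' := by
  have key := hU.ae_eq_zero_of_integral_contDiff_smul_eq_zero (μ := volume)
    (f := fun p => g p - g' p) (h.locInt_deriv.sub h'.locInt_deriv) (by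
    intro φ hφ hc hs
    have e1 := h.integral_eq φ hφ hc hs
    have e2 := h'.integral_eq φ hφ hc hs
    have hset : ∀ k : ℝ × ℝ → ℂ, ∫ p in U, φ p • k p = ∫ p, φ p • k p := by
      intro k
      apply setIntegral_eq_integral_of_forall_compl_eq_zero
      intro p hp
      have : φ p = 0 := by
        by_contra h0
        exact hp (hs (subset_tsupport _ h0))
      simp [this]
    simp only [smul_sub]
    rw [integral_sub (integrable_smul_of_tsupport hφ.continuous hc hs h.locInt_deriv)
      (integrable_smul_of_tsupport hφ.continuous hc hs h'.locInt_deriv), ← hset, ← hset]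
    have : -∫ p in U, φ p • g p = -∫ p in U, φ p • g' p := by rw [← e1, ← e2]
    rw [neg_inj.mp this, sub_self])
  rw [Filter.EventuallyEq, ae_restrict_iff' hU.measurableSet]
  filter_upwards [key] with p hp hpU
  exact sub_eq_zero.mp (hp hpU)

theorem HasL2WeakDeriv.hasWeakDeriv {U : Set (ℝ × ℝ)} {v : ℝ × ℝ} {f : ℝ × ℝ → ℂ}
    (h : HasL2WeakDeriv U v f) : HasWeakDeriv U v f (weakDeriv U v f) := by
  have h' : ∃ g, HasWeakDeriv U v f g := ⟨h.choose, h.choose_spec.1⟩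
  rw [weakDeriv, dif_pos h']
  exact h'.choose_spec

theorem HasL2WeakDeriv.memLp {U : Set (ℝ × ℝ)} (hU : IsOpen U) {v : ℝ × ℝ} {f : ℝ × ℝ → ℂ}
    (h : HasL2WeakDeriv U v f) : MemLp (weakDeriv U v f) 2 (volume.restrict U) := by
  obtain ⟨g, hg, hg2⟩ := id h
  exact (memLp_congr_ae (hg.ae_eq hU h.hasWeakDeriv)).mp hg2

theorem locallyIntegrableOn_congr_ae {U : Set (ℝ × ℝ)} (hU : IsOpen U) {f f' : ℝ × ℝ → ℂ}
    (hf : LocallyIntegrableOn f U) (h : f =ᵐ[volume.restrict U] f') :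
    LocallyIntegrableOn f' U := by
  rw [locallyIntegrableOn_iff hU.isLocallyClosed] at hf ⊢
  intro k hk hc
  exact (hf k hk hc).congr_fun_ae (ae_restrict_of_ae_restrict_of_subset hk h)

theorem HasWeakDeriv.congr_left {U : Set (ℝ × ℝ)} (hU : IsOpen U) {v : ℝ × ℝ}
    {f f' g : ℝ × ℝ → ℂ} (h : HasWeakDeriv U v f g) (hf : f =ᵐ[volume.restrict U] f') :
    HasWeakDeriv U v f' g where
  locInt_fun := locallyIntegrableOn_congr_ae hU h.locInt_fun hf
  locInt_deriv := h.locInt_deriv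
  integral_eq φ hφ hc hs := by
    rw [← h.integral_eq φ hφ hc hs]
    apply integral_congr_ae
    filter_upwards [hf] with p hp
    rw [hp]

theorem tsupport_fderiv_apply_subset' (φ : ℝ × ℝ → ℝ) (v : ℝ × ℝ) :
    tsupport (fun p => fderiv ℝ φ p v) ⊆ tsupport φ := by
  refine closure_minimal ?_ (isClosed_tsupport φ)
  intro p hp
  apply support_fderiv_subset ℝ
  intro h0
  exact hp (by simp [h0])

theorem HasWeakDeriv.add {U : Set (ℝ × ℝ)} {v : ℝ × ℝ} {f f' g g' : ℝ × ℝ → ℂ}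
    (h : HasWeakDeriv U v f g) (h' : HasWeakDeriv U v f' g') :
    HasWeakDeriv U v (f + f') (g + g') where
  locInt_fun := h.locInt_fun.add h'.locInt_fun
  locInt_deriv := h.locInt_deriv.add h'.locInt_deriv
  integral_eq φ hφ hc hs := by
    have hD : Continuous (fun p => fderiv ℝ φ p v) :=
      (hφ.continuous_fderiv (by simp)).clm_apply continuous_const
    have hDs := tsupport_fderiv_apply_subset' φ v
    have hDc : HasCompactSupport (fun p => fderiv ℝ φ p v) := hc.of_isClosed_subset
      (isClosed_tsupport _) hDs
    simp only [Pi.add_apply, smul_add]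
    rw [integral_add
      (integrable_smul_of_tsupport hD hDc (hDs.trans hs) h.locInt_fun).integrableOn
      (integrable_smul_of_tsupport hD hDc (hDs.trans hs) h'.locInt_fun).integrableOn,
      integral_add
      (integrable_smul_of_tsupport hφ.continuous hc hs h.locInt_deriv).integrableOn
      (integrable_smul_of_tsupport hφ.continuous hc hs h'.locInt_deriv).integrableOn,
      h.integral_eq φ hφ hc hs, h'.integral_eq φ hφ hc hs, neg_add]

theorem HasWeakDeriv.const_smul {U : Set (ℝ × ℝ)} {v : ℝ × ℝ} {f g : ℝ × ℝ → ℂ}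
    (h : HasWeakDeriv U v f g) (c : ℂ) : HasWeakDeriv U v (c • f) (c • g) where
  locInt_fun := h.locInt_fun.smul c
  locInt_deriv := h.locInt_deriv.smul c
  integral_eq φ hφ hc hs := by
    simp only [Pi.smul_apply, smul_comm _ c]
    rw [integral_smul, integral_smul, h.integral_eq φ hφ hc hs, smul_neg]

theorem HasL2WeakDeriv.congr {U : Set (ℝ × ℝ)} (hU : IsOpen U) {v : ℝ × ℝ}
    {f f' : ℝ × ℝ → ℂ} (h : HasL2WeakDeriv U v f) (hf : f =ᵐ[volume.restrict U] f') :
    HasL2WeakDeriv U v f' ∧ weakDeriv U v f' =ᵐ[volume.restrict U] weakDeriv U v f := by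
  obtain ⟨g, hg, hg2⟩ := id h
  have h' : HasL2WeakDeriv U v f' := ⟨g, hg.congr_left hU hf, hg2⟩
  exact ⟨h', h'.hasWeakDeriv.ae_eq hU (h.hasWeakDeriv.congr_left hU hf)⟩

theorem HasL2WeakDeriv.add {U : Set (ℝ × ℝ)} (hU : IsOpen U) {v : ℝ × ℝ}
    {f f' : ℝ × ℝ → ℂ} (h : HasL2WeakDeriv U v f) (h' : HasL2WeakDeriv U v f') :
    HasL2WeakDeriv U v (f + f') ∧
      weakDeriv U v (f + f') =ᵐ[volume.restrict U] weakDeriv U v f + weakDeriv U v f' := by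
  have h2 : HasL2WeakDeriv U v (f + f') :=
    ⟨_, h.hasWeakDeriv.add h'.hasWeakDeriv, (h.memLp hU).add (h'.memLp hU)⟩
  exact ⟨h2, h2.hasWeakDeriv.ae_eq hU (h.hasWeakDeriv.add h'.hasWeakDeriv)⟩

theorem HasL2WeakDeriv.const_smul {U : Set (ℝ × ℝ)} (hU : IsOpen U) {v : ℝ × ℝ}
    {f : ℝ × ℝ → ℂ} (h : HasL2WeakDeriv U v f) (c : ℂ) :
    HasL2WeakDeriv U v (c • f) ∧
      weakDeriv U v (c • f) =ᵐ[volume.restrict U] c • weakDeriv U v f := by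
  have h2 : HasL2WeakDeriv U v (c • f) :=
    ⟨_, h.hasWeakDeriv.const_smul c, (h.memLp hU).const_smul c⟩
  exact ⟨h2, h2.hasWeakDeriv.ae_eq hU (h.hasWeakDeriv.const_smul c)⟩

section Operator

variable {Γ : ℝ → EuclideanSpace ℝ (Fin 2)} {d : ℝ}

theorem measurable_signedCurvature (Γ : ℝ → EuclideanSpace ℝ (Fin 2)) :
    Measurable (signedCurvature Γ) := by
  unfold signedCurvature
  exact ((measurable_deriv Γ).inner (measurable_deriv _)).neg

theorem measurable_stripJacobian (Γ : ℝ → EuclideanSpace ℝ (Fin 2)) :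
    Measurable (stripJacobian Γ) := by
  unfold stripJacobian
  exact measurable_const.sub
    (measurable_snd.mul ((measurable_signedCurvature Γ).comp measurable_fst))

theorem IsCurvedStrip.jacobian_bounds (hs : IsCurvedStrip Γ d) :
    ∃ a b : ℝ, 0 < a ∧ ∀ p ∈ straightStrip d, a ≤ stripJacobian Γ p ∧ stripJacobian Γ p ≤ b := by
  obtain ⟨γm, γp, hm, hp, hpd, hb⟩ := hs.curvature_bounds
  have hd := hs.d_pos
  rw [lt_div_iff₀ hd] at hpd
  refine ⟨1 - d * γp, 1 + d * γm, by linarith, ?_⟩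
  rintro ⟨s, u⟩ ⟨-, hu0, hud⟩
  obtain ⟨h1, h2⟩ := hb s
  simp only [stripJacobian] at *
  constructor
  · nlinarith
  · nlinarith

theorem IsCurvedStrip.ae_iff (hs : IsCurvedStrip Γ d) :
    ae (stripMeasure Γ d) = ae (volume.restrict (straightStrip d)) := by
  have hm : Measurable fun p => ENNReal.ofReal (stripJacobian Γ p) :=
    (measurable_stripJacobian Γ).ennreal_ofReal
  obtain ⟨a, b, ha, hab⟩ := hs.jacobian_bounds
  apply le_antisymm
  · exact (withDensity_absolutelyContinuous _ _).ae_le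
  · refine (withDensity_absolutelyContinuous' hm.aemeasurable ?_).ae_le
    rw [ae_restrict_iff' (isOpen_straightStrip d).measurableSet]
    refine Filter.Eventually.of_forall fun p hp => ?_
    rw [ne_eq, ENNReal.ofReal_eq_zero, not_le]
    exact ha.trans_le (hab p hp).1

theorem memFormDomain_iff {f : StripL2 Γ d} :
    MemFormDomain Γ d f ↔ MemH1 (straightStrip d) f ∧
      ∀ φ : ℝ × ℝ → ℝ, ContDiff ℝ ∞ φ → HasCompactSupport φ → tsupport φ ⊆ {p | p.2 < d} →
        ∫ p in straightStrip d, fderiv ℝ φ p (0, 1) • f p =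
          -∫ p in straightStrip d, φ p • weakDeriv (straightStrip d) (0, 1) f p := by
  constructor
  · rintro ⟨h, t, ht, ht0⟩
    refine ⟨h, fun φ hφ hc hsupp => ?_⟩
    rw [ht.green φ hφ hc hsupp]
    have : ∫ s : ℝ, φ (s, 0) • t s = 0 := by
      apply integral_eq_zero_of_ae
      filter_upwards [ht0] with s h0
      simp [h0]
    rw [this, sub_zero]
  · rintro ⟨h, hg⟩
    refine ⟨h, 0, ⟨MemLp.zero, fun φ hφ hc hsupp => ?_⟩, by simp⟩
    rw [hg φ hφ hc hsupp]
    simp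

/-- Products of test functions with `L²` functions are integrable on the strip. -/
theorem integrable_test_smul {U : Set (ℝ × ℝ)} {φ : ℝ × ℝ → ℝ} (hφ : Continuous φ)
    (hc : HasCompactSupport φ) {k : ℝ × ℝ → ℂ} (hk : MemLp k 2 (volume.restrict U)) :
    Integrable (fun p => φ p • k p) (volume.restrict U) :=
  (hk.locallyIntegrable (by norm_num)).integrable_smul_left_of_hasCompactSupport hφ hc

theorem MemFormDomain.congr_aux (hs : IsCurvedStrip Γ d) {f : StripL2 Γ d} {k : ℝ × ℝ → ℂ}
    (hfk : f =ᵐ[stripMeasure Γ d] k) :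
    k =ᵐ[volume.restrict (straightStrip d)] f := by
  have := hfk.symm
  rwa [Filter.EventuallyEq, hs.ae_iff] at this

theorem MemFormDomain.of_ae (hs : IsCurvedStrip Γ d) {f : StripL2 Γ d} {k : ℝ × ℝ → ℂ}
    (hfk : f =ᵐ[stripMeasure Γ d] k) (hk : MemH1 (straightStrip d) k)
    (hg : ∀ φ : ℝ × ℝ → ℝ, ContDiff ℝ ∞ φ → HasCompactSupport φ → tsupport φ ⊆ {p | p.2 < d} →
        ∫ p in straightStrip d, fderiv ℝ φ p (0, 1) • k p =
          -∫ p in straightStrip d, φ p • weakDeriv (straightStrip d) (0, 1) k p) :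
    MemFormDomain Γ d f := by
  have hU := isOpen_straightStrip d
  have e := MemFormDomain.congr_aux hs hfk
  have eu := hk.deriv_u.congr hU e
  refine memFormDomain_iff.mpr ⟨⟨(memLp_congr_ae e).mp hk.memLp, (hk.deriv_s.congr hU e).1, eu.1⟩,
    fun φ hφ hc hsupp => ?_⟩
  have e1 : ∫ p in straightStrip d, fderiv ℝ φ p (0, 1) • f p =
      ∫ p in straightStrip d, fderiv ℝ φ p (0, 1) • k p := by
    apply integral_congr_ae
    filter_upwards [e] with p hp
    rw [hp]
  have e2 : ∫ p in straightStrip d, φ p • weakDeriv (straightStrip d) (0, 1) f p =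
      ∫ p in straightStrip d, φ p • weakDeriv (straightStrip d) (0, 1) k p := by
    apply integral_congr_ae
    filter_upwards [eu.2] with p hp
    rw [hp]
  rw [e1, e2, hg φ hφ hc hsupp]

theorem weakDeriv_add_ae (hs : IsCurvedStrip Γ d) {v : ℝ × ℝ} {f g : StripL2 Γ d}
    (hf : HasL2WeakDeriv (straightStrip d) v f) (hg : HasL2WeakDeriv (straightStrip d) v g) :
    weakDeriv (straightStrip d) v (f + g : StripL2 Γ d) =ᵐ[volume.restrict (straightStrip d)]
      weakDeriv (straightStrip d) v f + weakDeriv (straightStrip d) v g := by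
  have hU := isOpen_straightStrip d
  have h := hf.add hU hg
  exact ((h.1.congr hU (MemFormDomain.congr_aux hs (Lp.coeFn_add f g))).2).trans h.2

theorem weakDeriv_smul_ae (hs : IsCurvedStrip Γ d) {v : ℝ × ℝ} (c : ℂ) {f : StripL2 Γ d}
    (hf : HasL2WeakDeriv (straightStrip d) v f) :
    weakDeriv (straightStrip d) v (c • f : StripL2 Γ d) =ᵐ[volume.restrict (straightStrip d)]
      c • weakDeriv (straightStrip d) v f := by
  have hU := isOpen_straightStrip d
  have h := hf.const_smul hU c
  exact ((h.1.congr hU (MemFormDomain.congr_aux hs (Lp.coeFn_smul c f))).2).trans h.2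

theorem MemFormDomain.add (hs : IsCurvedStrip Γ d) {f g : StripL2 Γ d}
    (hf : MemFormDomain Γ d f) (hg : MemFormDomain Γ d g) : MemFormDomain Γ d (f + g) := by
  have hU := isOpen_straightStrip d
  obtain ⟨f1, f2⟩ := memFormDomain_iff.mp hf
  obtain ⟨g1, g2⟩ := memFormDomain_iff.mp hg
  have hu := f1.deriv_u.add hU g1.deriv_u
  refine MemFormDomain.of_ae hs (Lp.coeFn_add f g) ⟨f1.memLp.add g1.memLp,
    (f1.deriv_s.add hU g1.deriv_s).1, hu.1⟩ fun φ hφ hc hsupp => ?_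
  have hD : Continuous (fun p => fderiv ℝ φ p (0, 1)) :=
    (hφ.continuous_fderiv (by simp)).clm_apply continuous_const
  have hDc : HasCompactSupport (fun p => fderiv ℝ φ p (0, 1)) := hc.of_isClosed_subset
    (isClosed_tsupport _) (tsupport_fderiv_apply_subset' φ _)
  have e : ∫ p in straightStrip d, φ p • weakDeriv (straightStrip d) (0, 1) (⇑f + ⇑g) p =
      ∫ p in straightStrip d, (φ p • weakDeriv (straightStrip d) (0, 1) f p +
        φ p • weakDeriv (straightStrip d) (0, 1) g p) := by
    apply integral_congr_ae
    filter_upwards [hu.2] with p hp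
    rw [hp, Pi.add_apply, smul_add]
  simp only [Pi.add_apply, smul_add]
  rw [e, integral_add (integrable_test_smul hD hDc f1.memLp)
    (integrable_test_smul hD hDc g1.memLp),
    integral_add (integrable_test_smul hφ.continuous hc (f1.deriv_u.memLp hU))
    (integrable_test_smul hφ.continuous hc (g1.deriv_u.memLp hU)),
    f2 φ hφ hc hsupp, g2 φ hφ hc hsupp, neg_add]

theorem MemFormDomain.const_smul (hs : IsCurvedStrip Γ d) (c : ℂ) {f : StripL2 Γ d}
    (hf : MemFormDomain Γ d f) : MemFormDomain Γ d (c • f) := by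
  have hU := isOpen_straightStrip d
  obtain ⟨f1, f2⟩ := memFormDomain_iff.mp hf
  have hu := f1.deriv_u.const_smul hU c
  refine MemFormDomain.of_ae hs (Lp.coeFn_smul c f) ⟨f1.memLp.const_smul c,
    (f1.deriv_s.const_smul hU c).1, hu.1⟩ fun φ hφ hc hsupp => ?_
  have e : ∫ p in straightStrip d, φ p • weakDeriv (straightStrip d) (0, 1) (c • ⇑f) p =
      ∫ p in straightStrip d, c • (φ p • weakDeriv (straightStrip d) (0, 1) f p) := by
    apply integral_congr_ae
    filter_upwards [hu.2] with p hp
    rw [hp, Pi.smul_apply, smul_comm]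
  simp only [Pi.smul_apply, smul_comm _ c]
  rw [e, integral_smul, integral_smul, f2 φ hφ hc hsupp, smul_neg]

theorem integrable_stripFormIntegrand (hs : IsCurvedStrip Γ d) {f g : StripL2 Γ d}
    (hf : MemFormDomain Γ d f) (hg : MemFormDomain Γ d g) :
    Integrable (stripFormIntegrand Γ d f g) (volume.restrict (straightStrip d)) := by
  have hU := isOpen_straightStrip d
  obtain ⟨a, b, ha, hab⟩ := hs.jacobian_bounds
  have hJ := measurable_stripJacobian Γ
  have hprod : ∀ v, HasL2WeakDeriv (straightStrip d) v f → HasL2WeakDeriv (straightStrip d) v g →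
      Integrable (fun p => starRingEnd ℂ (weakDeriv (straightStrip d) v f p) *
        weakDeriv (straightStrip d) v g p) (volume.restrict (straightStrip d)) := by
    intro v h1 h2
    exact (h1.memLp hU).star.integrable_mul (h2.memLp hU)
  unfold stripFormIntegrand
  refine Integrable.add ?_ ?_
  · refine (hprod _ hf.memH1.deriv_s hg.memH1.deriv_s).bdd_mul (c := 1 / a)
      (Complex.measurable_ofReal.comp (measurable_const.div hJ)).aestronglyMeasurable ?_
    rw [ae_restrict_iff' hU.measurableSet]
    refine Filter.Eventually.of_forall fun p hp => ?_
    have h1 := (hab p hp).1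
    have h2 : 0 < stripJacobian Γ p := ha.trans_le h1
    rw [Complex.norm_real, Real.norm_of_nonneg (by positivity)]
    exact one_div_le_one_div_of_le ha h1
  · refine (hprod _ hf.memH1.deriv_u hg.memH1.deriv_u).bdd_mul (c := b)
      (Complex.measurable_ofReal.comp hJ).aestronglyMeasurable ?_
    rw [ae_restrict_iff' hU.measurableSet]
    refine Filter.Eventually.of_forall fun p hp => ?_
    obtain ⟨h1, h2⟩ := hab p hp
    rw [Complex.norm_real, Real.norm_of_nonneg (ha.le.trans h1)]
    exact h2

theorem stripForm_add_right (hs : IsCurvedStrip Γ d) {g f f' : StripL2 Γ d}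
    (hg : MemFormDomain Γ d g) (hf : MemFormDomain Γ d f) (hf' : MemFormDomain Γ d f') :
    stripForm Γ d g (f + f') = stripForm Γ d g f + stripForm Γ d g f' := by
  unfold stripForm
  rw [← integral_add (integrable_stripFormIntegrand hs hg hf)
    (integrable_stripFormIntegrand hs hg hf')]
  apply integral_congr_ae
  filter_upwards [weakDeriv_add_ae hs hf.memH1.deriv_s hf'.memH1.deriv_s,
    weakDeriv_add_ae hs hf.memH1.deriv_u hf'.memH1.deriv_u] with p h1 h2
  simp only [stripFormIntegrand, h1, h2, Pi.add_apply]
  ring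

theorem stripForm_smul_right (hs : IsCurvedStrip Γ d) (c : ℂ) {g f : StripL2 Γ d}
    (hf : MemFormDomain Γ d f) :
    stripForm Γ d g (c • f) = c * stripForm Γ d g f := by
  unfold stripForm
  rw [← smul_eq_mul, ← integral_smul]
  apply integral_congr_ae
  filter_upwards [weakDeriv_smul_ae hs c hf.memH1.deriv_s,
    weakDeriv_smul_ae hs c hf.memH1.deriv_u] with p h1 h2
  simp only [stripFormIntegrand, h1, h2, Pi.smul_apply, smul_eq_mul]
  ring

/-- Restrictions to the strip of test functions supported in the strip are in the form domain. -/
theorem exists_memFormDomain_of_test (hs : IsCurvedStrip Γ d) {ψ : ℝ × ℝ → ℝ}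
    (hψ : ContDiff ℝ ∞ ψ) (hψc : HasCompactSupport ψ) (hψs : tsupport ψ ⊆ straightStrip d) :
    ∃ f : StripL2 Γ d, MemFormDomain Γ d f ∧
      f =ᵐ[volume.restrict (straightStrip d)] fun p => (ψ p : ℂ) := by
  have hU := isOpen_straightStrip d
  have hψ0 : ∀ p ∉ straightStrip d, ψ p = 0 := fun p hp => by
    by_contra h0
    exact hp (hψs (subset_tsupport _ h0))
  have hD0 : ∀ (v : ℝ × ℝ), ∀ p ∉ straightStrip d, fderiv ℝ ψ p v = 0 := fun v p hp => by
    by_contra h0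
    exact hp (hψs (tsupport_fderiv_apply_subset' ψ v (subset_tsupport _ h0)))
  have hDcont : ∀ (φ : ℝ × ℝ → ℝ) (v : ℝ × ℝ), ContDiff ℝ ∞ φ →
      Continuous (fun p => fderiv ℝ φ p v) := fun φ v hφ =>
    (hφ.continuous_fderiv (by simp)).clm_apply continuous_const
  have hDc : ∀ (φ : ℝ × ℝ → ℝ) (v : ℝ × ℝ), HasCompactSupport φ →
      HasCompactSupport (fun p => fderiv ℝ φ p v) := fun φ v hφ => hφ.of_isClosed_subset
    (isClosed_tsupport _) (tsupport_fderiv_apply_subset' φ _)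
  -- integration by parts against an arbitrary test function
  have hparts : ∀ (v : ℝ × ℝ) (φ : ℝ × ℝ → ℝ), ContDiff ℝ ∞ φ → HasCompactSupport φ →
      ∫ p in straightStrip d, fderiv ℝ φ p v • (ψ p : ℂ) =
        -∫ p in straightStrip d, φ p • ((fderiv ℝ ψ p v : ℝ) : ℂ) := by
    intro v φ hφ hc
    have h := integral_mul_fderiv_eq_neg_fderiv_mul_of_integrable (μ := (volume : Measure (ℝ × ℝ)))
      (f := ψ) (g := φ) (v := v)
      (((hDcont ψ v hψ).mul hφ.continuous).integrable_of_hasCompactSupport (hc.mul_left))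
      ((hψ.continuous.mul (hDcont φ v hφ)).integrable_of_hasCompactSupport (hψc.mul_right))
      ((hψ.continuous.mul hφ.continuous).integrable_of_hasCompactSupport (hψc.mul_right))
      (fun p _ => (hψ.differentiable (by simp)) p) (fun p _ => (hφ.differentiable (by simp)) p)
    rw [setIntegral_eq_integral_of_forall_compl_eq_zero (fun p hp => by simp [hψ0 p hp]),
      setIntegral_eq_integral_of_forall_compl_eq_zero (fun p hp => by simp [hD0 v p hp])]
    have e1 : ∀ p, fderiv ℝ φ p v • (ψ p : ℂ) = ((ψ p * fderiv ℝ φ p v : ℝ) : ℂ) := fun p => by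
      rw [Complex.real_smul]; push_cast; ring
    have e2 : ∀ p, φ p • ((fderiv ℝ ψ p v : ℝ) : ℂ) = ((fderiv ℝ ψ p v * φ p : ℝ) : ℂ) :=
      fun p => by rw [Complex.real_smul]; push_cast; ring
    simp only [e1, e2]
    exact (integral_ofReal (𝕜 := ℂ)).trans ((congrArg Complex.ofReal h).trans
      ((Complex.ofReal_neg _).trans (congrArg Neg.neg (integral_ofReal (𝕜 := ℂ)).symm)))
  have hcL2 : ∀ (k : ℝ × ℝ → ℝ), Continuous k → HasCompactSupport k →
      MemLp (fun p => (k p : ℂ)) 2 (volume : Measure (ℝ × ℝ)) := fun k hk hkc =>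
    (Complex.continuous_ofReal.comp hk).memLp_of_hasCompactSupport
      (hkc.comp_left (g := fun x : ℝ => (x : ℂ)) (by simp))
  have hweak : ∀ v : ℝ × ℝ, HasWeakDeriv (straightStrip d) v (fun p => (ψ p : ℂ))
      (fun p => ((fderiv ℝ ψ p v : ℝ) : ℂ)) := fun v =>
    { locInt_fun := ((hcL2 ψ hψ.continuous hψc).locallyIntegrable
        (by norm_num)).locallyIntegrableOn _
      locInt_deriv := ((hcL2 _ (hDcont ψ v hψ) (hDc ψ v hψc)).locallyIntegrable
        (by norm_num)).locallyIntegrableOn _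
      integral_eq := fun φ hφ hc _ => hparts v φ hφ hc }
  have hL2 : ∀ v : ℝ × ℝ, HasL2WeakDeriv (straightStrip d) v (fun p => (ψ p : ℂ)) := fun v =>
    ⟨_, hweak v, (hcL2 _ (hDcont ψ v hψ) (hDc ψ v hψc)).restrict _⟩
  obtain ⟨a, b, ha, hab⟩ := hs.jacobian_bounds
  have hmem : MemLp (fun p => (ψ p : ℂ)) 2 (stripMeasure Γ d) := by
    refine MemLp.of_measure_le_smul (c := ENNReal.ofReal b) ENNReal.ofReal_ne_top ?_
      ((hcL2 ψ hψ.continuous hψc).restrict (straightStrip d))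
    rw [stripMeasure, ← withDensity_const]
    apply withDensity_mono
    rw [Filter.EventuallyLE, ae_restrict_iff' hU.measurableSet]
    exact Filter.Eventually.of_forall fun p hp => ENNReal.ofReal_le_ofReal (hab p hp).2
  have hcoe := hmem.coeFn_toLp
  refine ⟨hmem.toLp _, MemFormDomain.of_ae hs hcoe
    ⟨(hcL2 ψ hψ.continuous hψc).restrict _, hL2 _, hL2 _⟩ ?_,
    (MemFormDomain.congr_aux hs hcoe).symm⟩
  intro φ hφ hc _
  rw [hparts _ φ hφ hc]
  congr 1
  apply integral_congr_ae
  filter_upwards [(hweak (0, 1)).ae_eq hU (hL2 (0, 1)).hasWeakDeriv] with p hp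
  rw [hp]

/-- The form domain is dense: a vector which is orthogonal to it vanishes. -/
theorem eq_zero_of_orthogonal_formDomain (hs : IsCurvedStrip Γ d) {h : StripL2 Γ d}
    (hh : ∀ g : StripL2 Γ d, MemFormDomain Γ d g → inner ℂ g h = 0) : h = 0 := by
  have hU := isOpen_straightStrip d
  obtain ⟨a, b, ha, hab⟩ := hs.jacobian_bounds
  have hJm : Measurable fun p => ENNReal.ofReal (stripJacobian Γ p) :=
    (measurable_stripJacobian Γ).ennreal_ofReal
  have hint : ∀ k : ℝ × ℝ → ℂ, ∫ p, k p ∂(stripMeasure Γ d) =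
      ∫ p in straightStrip d, stripJacobian Γ p • k p := by
    intro k
    rw [stripMeasure, integral_withDensity_eq_integral_toReal_smul hJm (by simp)]
    apply setIntegral_congr_fun hU.measurableSet
    intro p hp
    simp only
    rw [ENNReal.toReal_ofReal (ha.le.trans (hab p hp).1)]
  have hle : volume.restrict (straightStrip d) ≤ ENNReal.ofReal (1 / a) • stripMeasure Γ d := by
    rw [stripMeasure, ← withDensity_smul _ hJm]
    conv_lhs => rw [← withDensity_one (μ := volume.restrict (straightStrip d))]
    apply withDensity_mono
    rw [Filter.EventuallyLE, ae_restrict_iff' hU.measurableSet]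
    refine Filter.Eventually.of_forall fun p hp => ?_
    rw [Pi.smul_apply, smul_eq_mul, ← ENNReal.ofReal_mul (by positivity), Pi.one_apply,
      ← ENNReal.ofReal_one]
    apply ENNReal.ofReal_le_ofReal
    rw [one_div, inv_mul_eq_div, one_le_div ha]
    exact (hab p hp).1
  have hL2 : MemLp h 2 (volume.restrict (straightStrip d)) :=
    (Lp.memLp h).of_measure_le_smul ENNReal.ofReal_ne_top hle
  have hJL2 : MemLp (fun p => stripJacobian Γ p • h p) 2 (volume.restrict (straightStrip d)) := by
    refine hL2.of_le_mul (c := b)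
      ((measurable_stripJacobian Γ).aestronglyMeasurable.smul hL2.aestronglyMeasurable) ?_
    rw [ae_restrict_iff' hU.measurableSet]
    refine Filter.Eventually.of_forall fun p hp => ?_
    rw [norm_smul, Real.norm_of_nonneg (ha.le.trans (hab p hp).1)]
    exact mul_le_mul_of_nonneg_right (hab p hp).2 (norm_nonneg _)
  have hloc : LocallyIntegrableOn (fun p => stripJacobian Γ p • h p) (straightStrip d) :=
    locallyIntegrableOn_of_locallyIntegrable_restrict (hJL2.locallyIntegrable (by norm_num))
  have key := hU.ae_eq_zero_of_integral_contDiff_smul_eq_zero (μ := volume) hloc (by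
    intro ψ hψ hψc hψs
    obtain ⟨g, hg, hge⟩ := exists_memFormDomain_of_test hs hψ hψc hψs
    have h0 := hh g hg
    rw [L2.inner_def, hint] at h0
    rw [← setIntegral_eq_integral_of_forall_compl_eq_zero (s := straightStrip d)
      (fun p hp => by
        have : ψ p = 0 := by
          by_contra h0
          exact hp (hψs (subset_tsupport _ h0))
        simp [this]), ← h0]
    apply integral_congr_ae
    filter_upwards [hge] with p hp
    rw [hp]
    simp only [RCLike.inner_apply, Complex.conj_ofReal, Complex.real_smul]
    ring)
  rw [Lp.eq_zero_iff_ae_eq_zero, Filter.EventuallyEq, hs.ae_iff,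
    ae_restrict_iff' hU.measurableSet]
  filter_upwards [key] with p hp hpU
  exact (smul_eq_zero.mp (hp hpU)).resolve_left (ha.trans_le (hab p hpU).1).ne'

/-- The graph of the operator associated with the form `q₀`: all pairs `(f, h)` with `f` in the form
domain and `q₀(g, f) = ⟨g, h⟩` for every `g` in the form domain. -/
def laplacianGraph (hs : IsCurvedStrip Γ d) : Submodule ℂ (StripL2 Γ d × StripL2 Γ d) where
  carrier := {x | MemFormDomain Γ d x.1 ∧
    ∀ g : StripL2 Γ d, MemFormDomain Γ d g → stripForm Γ d g x.1 = inner ℂ g x.2}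
  zero_mem' := by
    obtain ⟨f, hf, -⟩ := exists_memFormDomain_of_test hs (ψ := fun _ => 0) contDiff_const
      HasCompactSupport.zero (by simp [tsupport])
    have h0 : MemFormDomain Γ d (0 : StripL2 Γ d) := by
      simpa using hf.const_smul hs 0
    refine ⟨h0, fun g _ => ?_⟩
    have := stripForm_smul_right hs 0 (g := g) h0
    simpa using this
  add_mem' := by
    rintro ⟨f, h⟩ ⟨f', h'⟩ ⟨hf, e⟩ ⟨hf', e'⟩
    refine ⟨hf.add hs hf', fun g hg => ?_⟩
    have e1 := e g hg
    have e2 := e' g hg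
    simp only [Prod.mk_add_mk] at *
    rw [stripForm_add_right hs hg hf hf', e1, e2, inner_add_right]
  smul_mem' := by
    rintro c ⟨f, h⟩ ⟨hf, e⟩
    refine ⟨hf.const_smul hs c, fun g hg => ?_⟩
    have e1 := e g hg
    simp only [Prod.smul_mk] at *
    rw [stripForm_smul_right hs c hf, e1, inner_smul_right]

theorem laplacianGraph_single_valued (hs : IsCurvedStrip Γ d)
    (x : StripL2 Γ d × StripL2 Γ d) (hx : x ∈ laplacianGraph hs) (h0 : x.1 = 0) : x.2 = 0 := by
  have hz := (laplacianGraph hs).zero_mem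
  apply eq_zero_of_orthogonal_formDomain hs
  intro g hg
  have h1 := hx.2 g hg
  have h2 := hz.2 g hg
  rw [← h1, h0]
  simpa using h2

/-- The Dirichlet-Neumann Laplacian of the curved strip: the operator in
`L²(ℝ × (0, d), (1 - u γ(s)) ds du)` associated with the quadratic form `q₀`, that is,
the operator whose graph is `laplacianGraph hs`. -/
def dirichletNeumannLaplacian (hs : IsCurvedStrip Γ d) : StripL2 Γ d →ₗ.[ℂ] StripL2 Γ d :=
  (laplacianGraph hs).toLinearPMap

theorem graph_dirichletNeumannLaplacian (hs : IsCurvedStrip Γ d) :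
    (dirichletNeumannLaplacian hs).graph = laplacianGraph hs :=
  Submodule.toLinearPMap_graph_eq _ (laplacianGraph_single_valued hs)

end Operator

/-! ### The spectrum of an unbounded operator -/

/-- The resolvent set of a partially defined operator `A`: all `z` such that `A - z` is a bijection
of the domain of `A` onto the whole space, with a bounded inverse `R`. -/
def LinearPMap.unboundedResolventSet {H : Type*} [NormedAddCommGroup H] [NormedSpace ℂ H]
    (A : H →ₗ.[ℂ] H) : Set ℂ :=
  {z | ∃ R : H →L[ℂ] H,
    (∀ h : H, ∃ f : A.domain, (f : H) = R h ∧ A f - z • (f : H) = h) ∧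
    ∀ f : A.domain, R (A f - z • (f : H)) = f}

/-- The spectrum of a partially defined operator. -/
def LinearPMap.unboundedSpectrum {H : Type*} [NormedAddCommGroup H] [NormedSpace ℂ H]
    (A : H →ₗ.[ℂ] H) : Set ℂ :=
  A.unboundedResolventSetᶜ

/-- The spectrum of a self-adjoint operator, as a set of real numbers. -/
def LinearPMap.realSpectrum {H : Type*} [NormedAddCommGroup H] [NormedSpace ℂ H]
    (A : H →ₗ.[ℂ] H) : Set ℝ :=
  {x | (x : ℂ) ∈ A.unboundedSpectrum}

end

/-! The bound below the threshold comes from the trial function φ(s) sin(πu/(2d)), where φ is a wide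
cutoff equal to 1 on [-s₀, s₀]. The transverse factor is the ground state of the straight strip,
with eigenvalue π²/(4d²). Its transverse energy minus π²/(4d²) times the squared norm has the
density (π²/(4d²)) φ² (1 - uγ) cos(πu/d). Since cos(πu/d) has mean zero on (0, d) and first moment
-2d²/π², only the curvature term survives, and the excess equals ½ ∫ φ²γ
(`integral_jacobian_transverse`). As γ ≤ 0 off [-s₀, s₀], this is at most half of the negative
number B = ∫ γ over [-s₀, s₀] (`integral_cutoff_mul_signedCurvature_le`). The longitudinal energy is
at most a constant times ∫ φ'², which tends to 0 when the cutoff is stretched (`exists_cutoff`), so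
the total excess is negative (`exists_stripForm_lt`).

The passage from the form to the spectrum goes through one bounded operator. Let D be the gradient
on the form domain, with values in a product of weighted L² spaces chosen so that q₀(f, g) = ⟨Df,
Dg⟩. Its graph is closed, and compressing the orthogonal projection onto this graph to the first
factor gives T = (1 + D†D)⁻¹, a bounded nonnegative operator. The Laplacian A is T⁻¹ - 1
(`mem_graph_iff_formResolvent`), and T is injective because the form domain is dense.

Everything is then read off from T: self-adjointness of A, the lower bound -1 for its spectrum, and
the spectral point ‖T‖⁻¹ - 1, since ‖T‖ lies in the spectrum of the nonnegative operator T. The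
trial function bounds ‖T‖ below (`norm_pow_le_form_mul_formResolvent`), which places that point
below π²/(4d²). -/

/-! ### The resolvent at -1 as a compressed graph projection -/

/-- For a closed operator `D` with graph `G`, this is the operator `(1 + D†D)⁻¹`. -/
noncomputable def formResolvent {H E : Type*} [NormedAddCommGroup H] [InnerProductSpace ℂ H]
    [CompleteSpace H] [NormedAddCommGroup E] [InnerProductSpace ℂ E] [CompleteSpace E]
    (G : Submodule ℂ (WithLp 2 (H × E))) [G.HasOrthogonalProjection] : H →L[ℂ] H :=
  WithLp.fstL 2 ℂ H E ∘L G.starProjection ∘L (WithLp.fstL 2 ℂ H E).adjoint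

section FormResolvent

variable {H E : Type*} [NormedAddCommGroup H] [InnerProductSpace ℂ H]
    [CompleteSpace H] [NormedAddCommGroup E] [InnerProductSpace ℂ E] [CompleteSpace E]

theorem adjoint_fstL_apply (h : H) :
    (WithLp.fstL 2 ℂ H E).adjoint h = WithLp.toLp 2 (h, 0) := by
  refine ext_inner_left ℂ fun x => ?_
  rw [ContinuousLinearMap.adjoint_inner_right, WithLp.prod_inner_apply]
  simp

variable (G : Submodule ℂ (WithLp 2 (H × E))) [G.HasOrthogonalProjection]

/-- An orthogonal projection is nonnegative, and conjugation by a bounded operator and its adjoint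
preserves this. -/
theorem formResolvent_nonneg : 0 ≤ formResolvent G := by
  rw [ContinuousLinearMap.nonneg_iff_isPositive]
  have h : (G.starProjection).IsPositive := by
    have h1 := ContinuousLinearMap.IsPositive.conj_starProjection G
      (ContinuousLinearMap.isPositive_one (𝕜 := ℂ) (E := WithLp 2 (H × E)))
    convert h1 using 1
    exact G.isIdempotentElem_starProjection.eq.symm
  exact h.conj_adjoint _

theorem formResolvent_apply (h : H) :
    formResolvent G h = (G.starProjection (WithLp.toLp 2 (h, 0))).fst := by
  simp [formResolvent, adjoint_fstL_apply]

/-- The projection of (h, 0) onto G is the element of G whose difference from (h, 0) is orthogonal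
to G. When G is the graph of D and y = Df, this is the weak form ⟨g, h⟩ = ⟨g, f⟩ + ⟨Dg, Df⟩ of the
equation f + D†Df = h. -/
theorem eq_formResolvent_iff {f h : H} :
    f = formResolvent G h ↔ ∃ y : E, WithLp.toLp 2 (f, y) ∈ G ∧
      ∀ x ∈ G, inner ℂ x.fst h = inner ℂ x (WithLp.toLp 2 (f, y)) := by
  rw [formResolvent_apply]
  constructor
  · rintro rfl
    refine ⟨(G.starProjection (WithLp.toLp 2 (h, 0))).snd, G.starProjection_apply_mem _,
      fun x hx => ?_⟩
    have := inner_eq_zero_symm.mp (G.starProjection_inner_eq_zero (WithLp.toLp 2 (h, 0)) x hx)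
    rw [inner_sub_right, sub_eq_zero] at this
    simpa [WithLp.prod_inner_apply] using this
  · rintro ⟨y, hy, hx⟩
    have : G.starProjection (WithLp.toLp 2 (h, 0)) = WithLp.toLp 2 (f, y) := by
      refine Submodule.eq_starProjection_of_mem_of_inner_eq_zero hy fun x hxG => ?_
      rw [inner_eq_zero_symm, inner_sub_right, ← hx x hxG]
      simp [WithLp.prod_inner_apply]
    rw [this, WithLp.toLp_fst]

/-- The Rayleigh quotient of `(1 + D†D)⁻¹` is bounded below by the form of `1 + D†D`. -/
theorem norm_pow_le_form_mul_formResolvent {f : H} {y : E} (hf : WithLp.toLp 2 (f, y) ∈ G) :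
    ‖f‖ ^ 4 ≤ (‖f‖ ^ 2 + ‖y‖ ^ 2) * (‖formResolvent G‖ * ‖f‖ ^ 2) := by
  obtain ⟨z, hz, hx⟩ := (eq_formResolvent_iff G (f := formResolvent G f) (h := f)).mp rfl
  set w : WithLp 2 (H × E) := WithLp.toLp 2 (formResolvent G f, z) with hw
  -- With w the projection of (f, 0), testing against (f, y) gives ‖f‖² = ⟨(f, y), w⟩; testing
  -- against w itself gives ‖w‖² = ⟨Tf, f⟩.
  have h1 : ‖f‖ ^ 2 ≤ ‖WithLp.toLp 2 (f, y)‖ * ‖w‖ := by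
    have e := hx _ hf
    simp only [WithLp.toLp_fst, inner_self_eq_norm_sq_to_K] at e
    have := norm_inner_le_norm (𝕜 := ℂ) (WithLp.toLp 2 (f, y)) w
    rw [← e] at this
    simpa using this
  have h2 : ‖w‖ ^ 2 ≤ ‖formResolvent G‖ * ‖f‖ ^ 2 := by
    have e := hx _ hz
    rw [inner_self_eq_norm_sq_to_K] at e
    have h3 := norm_inner_le_norm (𝕜 := ℂ) (formResolvent G f) f
    have h4 := (formResolvent G).le_opNorm f
    have h5 : ‖inner ℂ (formResolvent G f) f‖ = ‖w‖ ^ 2 := by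
      have : inner ℂ (formResolvent G f) f = ((‖w‖ : ℂ)) ^ 2 := e
      rw [this]; simp
    nlinarith [norm_nonneg f]
  calc ‖f‖ ^ 4 = (‖f‖ ^ 2) ^ 2 := by ring
    _ ≤ (‖WithLp.toLp 2 (f, y)‖ * ‖w‖) ^ 2 := by gcongr
    _ = ‖WithLp.toLp 2 (f, y)‖ ^ 2 * ‖w‖ ^ 2 := by ring
    _ ≤ ‖WithLp.toLp 2 (f, y)‖ ^ 2 * (‖formResolvent G‖ * ‖f‖ ^ 2) := by gcongr
    _ = _ := by rw [WithLp.prod_norm_sq_eq_of_L2, WithLp.toLp_fst, WithLp.toLp_snd]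

end FormResolvent

/-! ### Operators of the form A = T⁻¹ - 1 with T bounded -/

namespace LinearPMap

variable {H : Type*} [NormedAddCommGroup H] [InnerProductSpace ℂ H]
  {A : H →ₗ.[ℂ] H} {T : H →L[ℂ] H}

theorem apply_add_eq_of_graph (hAT : ∀ f h, (f, h) ∈ A.graph ↔ f = T (f + h)) (f : A.domain) :
    (f : H) = T (f + A f) :=
  (hAT _ _).mp (A.mem_graph f)

/-- The hypothesis `hAT` expresses A = T⁻¹ - 1 through graphs, so the domain of A is the range of T,
and vectors Tw parametrize it. -/
theorem exists_domain_of_graph (hAT : ∀ f h, (f, h) ∈ A.graph ↔ f = T (f + h)) (w : H) :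
    ∃ f : A.domain, (f : H) = T w ∧ A f = w - T w := by
  have h : (T w, w - T w) ∈ A.graph := by rw [hAT]; simp
  obtain ⟨f, hf1, hf2⟩ := (LinearPMap.mem_graph_iff A).mp h
  exact ⟨f, hf1, hf2⟩

/-- The inverse of an injective self-adjoint operator is self-adjoint, and subtracting 1 does not
change this. The range of T is dense because its orthogonal complement is the kernel of T. -/
theorem isSelfAdjoint_of_graph [CompleteSpace H] (hT : IsSelfAdjoint T) (hinj : Function.Injective T)
    (hAT : ∀ f h, (f, h) ∈ A.graph ↔ f = T (f + h)) : IsSelfAdjoint A := by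
  have hsym : ∀ x y, inner ℂ (T x) y = inner ℂ x (T y) := fun x y => by
    conv_lhs => rw [← hT.adjoint_eq]
    exact ContinuousLinearMap.adjoint_inner_left _ _ _
  have hdense : Dense (A.domain : Set H) := by
    rw [Submodule.dense_iff_topologicalClosure_eq_top, Submodule.topologicalClosure_eq_top_iff,
      Submodule.eq_bot_iff]
    intro x hx
    apply hinj
    rw [_root_.map_zero]
    refine ext_inner_left ℂ fun w => ?_
    obtain ⟨f, hf, -⟩ := exists_domain_of_graph hAT w
    rw [← hsym, ← hf, inner_zero_right]
    exact (Submodule.mem_orthogonal _ _).mp hx f f.2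
  rw [isSelfAdjoint_def]
  apply eq_of_eq_graph
  rw [adjoint_graph_eq_graph_adjoint hdense]
  ext ⟨x, y⟩
  rw [Submodule.mem_adjoint_iff, hAT]
  simp only [hAT, sub_eq_zero]
  constructor
  · intro h
    refine ext_inner_left ℂ fun w => ?_
    -- The pairs (Tw, w - Tw) exhaust the graph of A, and the adjoint relation on them reads ⟨w, x⟩
    -- = ⟨w, T(x + y)⟩.
    have := h (T w) (w - T w) (by simp)
    rw [inner_sub_left, hsym, hsym, sub_eq_iff_eq_add] at this
    rw [this, _root_.map_add, inner_add_right, add_comm]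
  · intro h a b hab
    have h1 : inner ℂ (a + b) x = inner ℂ a (x + y) := by
      conv_lhs => rw [h]
      rw [← hsym, ← hab]
    rw [inner_add_left, inner_add_right] at h1
    exact add_left_cancel h1

/-- On the domain, A - x = (1 + x)((1 + x)⁻¹ - T)T⁻¹. For x < -1 the number (1 + x)⁻¹ is negative,
hence outside the spectrum of the nonnegative operator T, and the middle factor is invertible. -/
theorem neg_one_le_of_mem_realSpectrum [CompleteSpace H] (hT : 0 ≤ T)
    (hAT : ∀ f h, (f, h) ∈ A.graph ↔ f = T (f + h)) {x : ℝ} (hx : x ∈ A.realSpectrum) :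
    -1 ≤ x := by
  by_contra! hlt
  refine hx ?_
  have hne : (1 + x) ≠ 0 := by linarith
  have hneC : (1 + x : ℂ) ≠ 0 := by exact_mod_cast hne
  have hnot : ((1 + x)⁻¹ : ℝ) ∉ spectrum ℝ T := fun h => by
    have h1 := spectrum_nonneg_of_nonneg hT h
    have : (1 + x)⁻¹ < 0 := inv_lt_zero.mpr (by linarith)
    linarith
  rw [spectrum.notMem_iff] at hnot
  obtain ⟨S, hS⟩ := hnot.exists_right_inv
  obtain ⟨S', hS'⟩ := hnot.exists_left_inv
  have hSS : S' = S := left_inv_eq_right_inv hS' hS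
  subst hSS
  have hS1 : ∀ w, (1 + x : ℂ)⁻¹ • S' w - T (S' w) = w := fun w => by
    have := congrArg (fun B : H →L[ℂ] H => B w) hS
    simp only [mul_apply_eq_comp, _root_.sub_apply,
      one_apply_eq_self, Algebra.algebraMap_eq_smul_one,
      _root_.smul_apply] at this
    conv_rhs => rw [← this]
    rw [← Complex.coe_smul]
    push_cast
    rfl
  have hS2 : ∀ w, S' ((1 + x : ℂ)⁻¹ • w - T w) = w := fun w => by
    have := congrArg (fun B : H →L[ℂ] H => B w) hS'
    simp only [mul_apply_eq_comp, _root_.sub_apply,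
      one_apply_eq_self, Algebra.algebraMap_eq_smul_one,
      _root_.smul_apply] at this
    conv_rhs => rw [← this]
    rw [← Complex.coe_smul]
    push_cast
    rfl
  -- Inverting the three factors gives the resolvent (1 + x)⁻¹ T S', with S' the inverse of (1 +
  -- x)⁻¹ - T.
  refine ⟨(1 + x : ℂ)⁻¹ • (T ∘L S'), fun h => ?_, fun f => ?_⟩
  · obtain ⟨f, hf, hAf⟩ := exists_domain_of_graph hAT ((1 + x : ℂ)⁻¹ • S' h)
    refine ⟨f, by rw [hf]; simp, ?_⟩
    rw [hAf, hf]
    conv_rhs => rw [← hS1 h]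
    rw [_root_.map_smul]
    match_scalars
    · ring
    · field_simp
      ring
  · have hf := apply_add_eq_of_graph hAT f
    set w := (f : H) + A f with hw
    have hAf : A f = w - T w := by rw [← hf, hw]; abel
    have e : A f - (x : ℂ) • (f : H) = (1 + x : ℂ) • ((1 + x : ℂ)⁻¹ • w - T w) := by
      rw [hAf, hf, smul_sub, smul_inv_smul₀ hneC]
      module
    rw [e]
    simp only [_root_.smul_apply, ContinuousLinearMap.comp_apply, _root_.map_smul, hS2]
    rw [smul_inv_smul₀ hneC, ← hf]

/-- With x = t⁻¹ - 1 one has t(A - x)T = t - T. A bounded inverse of A - x would thus make t - T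
bijective, hence invertible by the open mapping theorem. -/
theorem mem_realSpectrum_of_mem_spectrum [CompleteSpace H] (hinj : Function.Injective T)
    (hAT : ∀ f h, (f, h) ∈ A.graph ↔ f = T (f + h)) {t : ℝ} (ht : t ≠ 0)
    (htT : t ∈ spectrum ℝ T) : t⁻¹ - 1 ∈ A.realSpectrum := by
  rintro ⟨R, hR1, hR2⟩
  have htC : (t : ℂ) ≠ 0 := by exact_mod_cast ht
  refine spectrum.mem_iff.mp htT ?_
  have happ : ∀ w, (algebraMap ℝ (H →L[ℂ] H) t - T) w = (t : ℂ) • w - T w := fun w => by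
    rw [_root_.sub_apply, Algebra.algebraMap_eq_smul_one,
      _root_.smul_apply, one_apply_eq_self, Complex.coe_smul]
  have key : ∀ w : H, ∀ f : A.domain, (f : H) = T w → A f = w - T w →
      (t : ℂ) • (A f - ((t⁻¹ - 1 : ℝ) : ℂ) • (f : H)) = (t : ℂ) • w - T w := by
    intro w f hf hAf
    rw [hAf, hf]
    push_cast
    match_scalars
    · ring
    · field_simp
      ring
  rw [ContinuousLinearMap.isUnit_iff_bijective]
  constructor
  · rw [injective_iff_map_eq_zero]
    intro w hw
    obtain ⟨f, hf, hAf⟩ := exists_domain_of_graph hAT w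
    have h1 := key w f hf hAf
    rw [← happ, hw, smul_eq_zero, or_iff_right htC] at h1
    have h2 := hR2 f
    rw [h1, _root_.map_zero] at h2
    apply hinj
    rw [← hf, ← h2, _root_.map_zero]
  · intro h
    obtain ⟨f, -, hAf⟩ := hR1 ((t : ℂ)⁻¹ • h)
    have hf := apply_add_eq_of_graph hAT f
    refine ⟨f + A f, ?_⟩
    rw [happ, ← key _ f hf (by rw [← hf]; abel), hAf, smul_inv_smul₀ htC]

end LinearPMap

/-- The variational bound: if `A = D†D`, where `D` has the graph `G`, and `‖D f‖² < c ‖f‖²`, then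
the spectrum of `A` has a point below `c`. -/
theorem exists_mem_realSpectrum_lt {H E : Type*} [NormedAddCommGroup H] [InnerProductSpace ℂ H]
    [CompleteSpace H] [NormedAddCommGroup E] [InnerProductSpace ℂ E] [CompleteSpace E]
    (G : Submodule ℂ (WithLp 2 (H × E))) [G.HasOrthogonalProjection] {A : H →ₗ.[ℂ] H}
    (hinj : Function.Injective (formResolvent G))
    (hAT : ∀ f h, (f, h) ∈ A.graph ↔ f = formResolvent G (f + h)) {c : ℝ} {f : H} {y : E}
    (hf : WithLp.toLp 2 (f, y) ∈ G) (hlt : ‖y‖ ^ 2 < c * ‖f‖ ^ 2) :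
    ∃ x ∈ A.realSpectrum, x < c := by
  have hf0 : 0 < ‖f‖ := by
    rw [norm_pos_iff]
    rintro rfl
    simp only [norm_zero] at hlt
    nlinarith [sq_nonneg ‖y‖]
  have hc : 0 < c := by
    by_contra! h
    nlinarith [sq_nonneg ‖y‖, sq_nonneg ‖f‖]
  have hnt : Nontrivial H := ⟨⟨f, 0, norm_pos_iff.mp hf0⟩⟩
  -- The norm of a nonnegative operator is its largest spectral value; the decreasing map t ↦ t⁻¹ -
  -- 1 turns it into a low spectral point of A.
  have hspec := CStarAlgebra.norm_mem_spectrum_of_nonneg (formResolvent_nonneg G)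
  have hle := norm_pow_le_form_mul_formResolvent G hf
  set t := ‖formResolvent G‖ with ht
  -- Dividing `hle` by ‖f‖⁴ gives 1 ≤ (1 + ‖y‖²/‖f‖²) t, and the quotient is less than c.
  have h1 : 1 < (1 + c) * t := by
    have hf2 : 0 < ‖f‖ ^ 2 := by positivity
    have h2 : ‖f‖ ^ 2 ≤ (‖f‖ ^ 2 + ‖y‖ ^ 2) * t := by
      refine le_of_mul_le_mul_right ?_ hf2
      calc _ = ‖f‖ ^ 4 := by ring
        _ ≤ _ := hle
        _ = _ := by ring
    have ht0 : 0 < t := by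
      by_contra! h
      nlinarith [sq_nonneg ‖y‖]
    have h3 : (‖f‖ ^ 2 + ‖y‖ ^ 2) * t < (‖f‖ ^ 2 + c * ‖f‖ ^ 2) * t := by gcongr
    by_contra! h
    nlinarith
  have ht0 : 0 < t := by
    by_contra! h
    nlinarith
  refine ⟨t⁻¹ - 1, LinearPMap.mem_realSpectrum_of_mem_spectrum hinj hAT ht0.ne' hspec, ?_⟩
  have : t⁻¹ < 1 + c := by
    rw [inv_lt_iff_one_lt_mul₀ ht0]
    linarith
  linarith

/-! ### Weighted L² spaces on the strip -/

/-- `μ` has the density `w` on the strip, and `w` is bounded and bounded away from zero. -/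
structure IsStripWeight (d : ℝ) (w : ℝ × ℝ → ℝ) (μ : Measure (ℝ × ℝ)) : Prop where
  measurable : Measurable w
  bounds : ∃ a b : ℝ, 0 < a ∧ ∀ p ∈ straightStrip d, a ≤ w p ∧ w p ≤ b
  eq : μ = (volume.restrict (straightStrip d)).withDensity fun p => ENNReal.ofReal (w p)

namespace IsStripWeight

variable {d : ℝ} {w : ℝ × ℝ → ℝ} {μ : Measure (ℝ × ℝ)}

theorem pos (hw : IsStripWeight d w μ) {p : ℝ × ℝ} (hp : p ∈ straightStrip d) : 0 < w p := by
  obtain ⟨a, b, ha, hab⟩ := hw.bounds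
  exact ha.trans_le (hab p hp).1

theorem ae_pos (hw : IsStripWeight d w μ) :
    ∀ᵐ p ∂(volume.restrict (straightStrip d)), 0 < w p := by
  rw [ae_restrict_iff' (isOpen_straightStrip d).measurableSet]
  exact Filter.Eventually.of_forall fun p hp => hw.pos hp

/-- Positivity of w makes the two measures mutually absolutely continuous. Almost-everywhere
identities can therefore move between the weighted spaces and Lebesgue measure, to which weak
derivatives refer. -/
theorem ae_eq (hw : IsStripWeight d w μ) : ae μ = ae (volume.restrict (straightStrip d)) := by
  rw [hw.eq]
  apply le_antisymm
  · exact (withDensity_absolutelyContinuous _ _).ae_le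
  · refine (withDensity_absolutelyContinuous' hw.measurable.ennreal_ofReal.aemeasurable ?_).ae_le
    filter_upwards [hw.ae_pos] with p hp
    rwa [ne_eq, ENNReal.ofReal_eq_zero, not_le]

theorem le_smul (hw : IsStripWeight d w μ) :
    ∃ b : ℝ, μ ≤ ENNReal.ofReal b • volume.restrict (straightStrip d) := by
  obtain ⟨a, b, ha, hab⟩ := hw.bounds
  refine ⟨b, ?_⟩
  rw [hw.eq, ← withDensity_const]
  apply withDensity_mono
  rw [Filter.EventuallyLE, ae_restrict_iff' (isOpen_straightStrip d).measurableSet]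
  exact Filter.Eventually.of_forall fun p hp => ENNReal.ofReal_le_ofReal (hab p hp).2

theorem volume_le_smul (hw : IsStripWeight d w μ) :
    ∃ c : ℝ, volume.restrict (straightStrip d) ≤ ENNReal.ofReal c • μ := by
  obtain ⟨a, b, ha, hab⟩ := hw.bounds
  refine ⟨1 / a, ?_⟩
  rw [hw.eq, ← withDensity_smul _ hw.measurable.ennreal_ofReal]
  conv_lhs => rw [← withDensity_one (μ := volume.restrict (straightStrip d))]
  apply withDensity_mono
  rw [Filter.EventuallyLE, ae_restrict_iff' (isOpen_straightStrip d).measurableSet]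
  refine Filter.Eventually.of_forall fun p hp => ?_
  rw [Pi.smul_apply, smul_eq_mul, ← ENNReal.ofReal_mul (by positivity), Pi.one_apply,
    ← ENNReal.ofReal_one]
  apply ENNReal.ofReal_le_ofReal
  rw [one_div, inv_mul_eq_div, one_le_div ha]
  exact (hab p hp).1

theorem memLp_iff (hw : IsStripWeight d w μ) {f : ℝ × ℝ → ℂ} :
    MemLp f 2 μ ↔ MemLp f 2 (volume.restrict (straightStrip d)) := by
  obtain ⟨b, hb⟩ := hw.le_smul
  obtain ⟨c, hc⟩ := hw.volume_le_smul
  exact ⟨fun h => h.of_measure_le_smul ENNReal.ofReal_ne_top hc,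
    fun h => h.of_measure_le_smul ENNReal.ofReal_ne_top hb⟩

theorem integral_eq (hw : IsStripWeight d w μ) (k : ℝ × ℝ → ℂ) :
    ∫ p, k p ∂μ = ∫ p in straightStrip d, w p • k p := by
  rw [hw.eq, integral_withDensity_eq_integral_toReal_smul hw.measurable.ennreal_ofReal (by simp)]
  apply integral_congr_ae
  filter_upwards [hw.ae_pos] with p hp
  rw [ENNReal.toReal_ofReal hp.le]

theorem integrable_smul (hw : IsStripWeight d w μ) {k : ℝ × ℝ → ℂ} (hk : Integrable k μ) :
    Integrable (fun p => w p • k p) (volume.restrict (straightStrip d)) := by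
  rw [hw.eq, integrable_withDensity_iff_integrable_smul' hw.measurable.ennreal_ofReal
    (by simp)] at hk
  refine hk.congr ?_
  filter_upwards [hw.ae_pos] with p hp
  rw [ENNReal.toReal_ofReal hp.le]

/-- Integration against a test function is a continuous functional on the weighted space. -/
theorem exists_testPairing (hw : IsStripWeight d w μ) {φ : ℝ × ℝ → ℝ} (hφ : Continuous φ)
    (hc : HasCompactSupport φ) :
    ∃ ℓ : Lp ℂ 2 μ →L[ℂ] ℂ, ∀ f : Lp ℂ 2 μ, ℓ f = ∫ p in straightStrip d, φ p • f p := by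
  obtain ⟨a, b, ha, hab⟩ := hw.bounds
  -- The Riesz representative is φ/w: the weight in the inner product cancels the denominator.
  have hm : MemLp (fun p => ((φ p / w p : ℝ) : ℂ)) 2 μ := by
    rw [hw.memLp_iff]
    have h1 : MemLp φ 2 (volume.restrict (straightStrip d)) :=
      (hφ.memLp_of_hasCompactSupport hc).restrict _
    refine h1.of_le_mul (c := 1 / a) (Complex.measurable_ofReal.comp
      (hφ.measurable.div hw.measurable)).aestronglyMeasurable ?_
    rw [ae_restrict_iff' (isOpen_straightStrip d).measurableSet]
    refine Filter.Eventually.of_forall fun p hp => ?_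
    have h2 := (hab p hp).1
    have h3 := hw.pos hp
    rw [Complex.norm_real, norm_div, Real.norm_of_nonneg h3.le, div_eq_inv_mul, one_div]
    gcongr
  refine ⟨innerSL ℂ (hm.toLp _), fun f => ?_⟩
  rw [innerSL_apply_apply, L2.inner_def, hw.integral_eq]
  apply integral_congr_ae
  have h4 := hm.coeFn_toLp
  rw [Filter.EventuallyEq, hw.ae_eq] at h4
  filter_upwards [h4, hw.ae_pos] with p hp hp'
  rw [hp, RCLike.inner_apply, Complex.conj_ofReal]
  have : (w p : ℂ) ≠ 0 := by exact_mod_cast hp'.ne'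
  simp only [Complex.real_smul]
  push_cast
  field_simp

theorem inner_eq (hw : IsStripWeight d w μ) (f g : Lp ℂ 2 μ) :
    inner ℂ f g = ∫ p in straightStrip d, (w p : ℂ) * (starRingEnd ℂ (f p) * g p) := by
  rw [L2.inner_def, hw.integral_eq]
  simp only [RCLike.inner_apply, Complex.real_smul, mul_comm (g _)]

theorem integrable_inner (hw : IsStripWeight d w μ) (f g : Lp ℂ 2 μ) :
    Integrable (fun p => (w p : ℂ) * (starRingEnd ℂ (f p) * g p))
      (volume.restrict (straightStrip d)) := by
  have := hw.integrable_smul (L2.integrable_inner (𝕜 := ℂ) f g)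
  simpa only [RCLike.inner_apply, Complex.real_smul, mul_comm (g _)] using this

end IsStripWeight

/-! ### The closed gradient and the Laplacian as D†D -/

/-- The measure `(1 - u γ(s))⁻¹ ds du` on `ℝ × (0, d)`. -/
noncomputable def stripInvMeasure (Γ : ℝ → EuclideanSpace ℝ (Fin 2)) (d : ℝ) :
    Measure (ℝ × ℝ) :=
  (volume.restrict (straightStrip d)).withDensity fun p => ENNReal.ofReal (1 / stripJacobian Γ p)

/-- The space containing the gradients of the functions in the form domain. -/
abbrev StripGradL2 (Γ : ℝ → EuclideanSpace ℝ (Fin 2)) (d : ℝ) : Type :=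
  WithLp 2 (Lp ℂ 2 (stripInvMeasure Γ d) × StripL2 Γ d)

section FormGraph

variable {Γ : ℝ → EuclideanSpace ℝ (Fin 2)} {d : ℝ}

theorem IsCurvedStrip.isStripWeight (hs : IsCurvedStrip Γ d) :
    IsStripWeight d (stripJacobian Γ) (stripMeasure Γ d) where
  measurable := measurable_stripJacobian Γ
  bounds := hs.jacobian_bounds
  eq := rfl

theorem IsCurvedStrip.isStripWeight_inv (hs : IsCurvedStrip Γ d) :
    IsStripWeight d (fun p => 1 / stripJacobian Γ p) (stripInvMeasure Γ d) where
  measurable := measurable_const.div (measurable_stripJacobian Γ)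
  bounds := by
    obtain ⟨a, b, ha, hab⟩ := hs.jacobian_bounds
    -- The sign of b is not given, and `max b 1` keeps the lower bound positive.
    refine ⟨1 / max b 1, 1 / a, by positivity, fun p hp => ?_⟩
    obtain ⟨h1, h2⟩ := hab p hp
    have h3 : 0 < stripJacobian Γ p := ha.trans_le h1
    exact ⟨one_div_le_one_div_of_le h3 (h2.trans (le_max_left _ _)),
      one_div_le_one_div_of_le ha h1⟩
  eq := rfl

theorem continuous_fderiv_apply_const {φ : ℝ × ℝ → ℝ} (hφ : ContDiff ℝ ∞ φ) (v : ℝ × ℝ) :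
    Continuous (fun p => fderiv ℝ φ p v) :=
  (hφ.continuous_fderiv (by simp)).clm_apply continuous_const

theorem HasCompactSupport.fderiv_apply_const {φ : ℝ × ℝ → ℝ} (hc : HasCompactSupport φ)
    (v : ℝ × ℝ) : HasCompactSupport (fun p => fderiv ℝ φ p v) :=
  hc.of_isClosed_subset (isClosed_tsupport _) (tsupport_fderiv_apply_subset' φ v)

/-- The graph of the gradient on the form domain: the pairs of `f` and `(∂f/∂s, ∂f/∂u)`. -/
def formGraph (hs : IsCurvedStrip Γ d) :
    Submodule ℂ (WithLp 2 (StripL2 Γ d × StripGradL2 Γ d)) where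
  carrier := {x |
    (∀ φ : ℝ × ℝ → ℝ, ContDiff ℝ ∞ φ → HasCompactSupport φ → tsupport φ ⊆ straightStrip d →
      ∫ p in straightStrip d, fderiv ℝ φ p (1, 0) • x.fst p =
        -∫ p in straightStrip d, φ p • x.snd.fst p) ∧
    -- These test functions need not vanish at u = 0, so the absence of a boundary term encodes the
    -- Dirichlet condition together with the weak derivative.
    (∀ φ : ℝ × ℝ → ℝ, ContDiff ℝ ∞ φ → HasCompactSupport φ → tsupport φ ⊆ {p | p.2 < d} →
      ∫ p in straightStrip d, fderiv ℝ φ p (0, 1) • x.fst p =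
        -∫ p in straightStrip d, φ p • x.snd.snd p)}
  zero_mem' := by
    constructor <;> intro φ hφ hc _
    -- Written with the functionals ℓ and m, the condition is linear in x, and no representatives of
    -- L² classes have to be compared.
    · obtain ⟨ℓ, hℓ⟩ := hs.isStripWeight.exists_testPairing
        (continuous_fderiv_apply_const hφ (1, 0)) (hc.fderiv_apply_const _)
      obtain ⟨m, hm⟩ := hs.isStripWeight_inv.exists_testPairing hφ.continuous hc
      rw [← hℓ, ← hm]
      simp
    · obtain ⟨ℓ, hℓ⟩ := hs.isStripWeight.exists_testPairing
        (continuous_fderiv_apply_const hφ (0, 1)) (hc.fderiv_apply_const _)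
      obtain ⟨m, hm⟩ := hs.isStripWeight.exists_testPairing hφ.continuous hc
      rw [← hℓ, ← hm]
      simp
  add_mem' := by
    rintro x y ⟨hx, hx'⟩ ⟨hy, hy'⟩
    constructor <;> intro φ hφ hc hsupp
    · obtain ⟨ℓ, hℓ⟩ := hs.isStripWeight.exists_testPairing
        (continuous_fderiv_apply_const hφ (1, 0)) (hc.fderiv_apply_const _)
      obtain ⟨m, hm⟩ := hs.isStripWeight_inv.exists_testPairing hφ.continuous hc
      have h1 := hx φ hφ hc hsupp
      have h2 := hy φ hφ hc hsupp
      rw [← hℓ, ← hm] at h1 h2 ⊢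
      simp only [WithLp.add_fst, WithLp.add_snd, map_add, h1, h2, neg_add]
    · obtain ⟨ℓ, hℓ⟩ := hs.isStripWeight.exists_testPairing
        (continuous_fderiv_apply_const hφ (0, 1)) (hc.fderiv_apply_const _)
      obtain ⟨m, hm⟩ := hs.isStripWeight.exists_testPairing hφ.continuous hc
      have h1 := hx' φ hφ hc hsupp
      have h2 := hy' φ hφ hc hsupp
      rw [← hℓ, ← hm] at h1 h2 ⊢
      simp only [WithLp.add_fst, WithLp.add_snd, map_add, h1, h2, neg_add]
  smul_mem' := by
    rintro c x ⟨hx, hx'⟩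
    constructor <;> intro φ hφ hc hsupp
    · obtain ⟨ℓ, hℓ⟩ := hs.isStripWeight.exists_testPairing
        (continuous_fderiv_apply_const hφ (1, 0)) (hc.fderiv_apply_const _)
      obtain ⟨m, hm⟩ := hs.isStripWeight_inv.exists_testPairing hφ.continuous hc
      have h1 := hx φ hφ hc hsupp
      rw [← hℓ, ← hm] at h1 ⊢
      simp only [WithLp.smul_fst, WithLp.smul_snd, map_smul, h1, smul_neg]
    · obtain ⟨ℓ, hℓ⟩ := hs.isStripWeight.exists_testPairing
        (continuous_fderiv_apply_const hφ (0, 1)) (hc.fderiv_apply_const _)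
      obtain ⟨m, hm⟩ := hs.isStripWeight.exists_testPairing hφ.continuous hc
      have h1 := hx' φ hφ hc hsupp
      rw [← hℓ, ← hm] at h1 ⊢
      simp only [WithLp.smul_fst, WithLp.smul_snd, map_smul, h1, smul_neg]

/-- Each test function imposes the equality of two continuous functionals, and the graph is the
intersection of these closed sets. This is the closedness of the form q₀. -/
theorem isClosed_formGraph (hs : IsCurvedStrip Γ d) :
    IsClosed (formGraph hs : Set (WithLp 2 (StripL2 Γ d × StripGradL2 Γ d))) := by
  have hf : Continuous fun x : WithLp 2 (StripL2 Γ d × StripGradL2 Γ d) => x.fst :=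
    (WithLp.fstL 2 ℂ (StripL2 Γ d) (StripGradL2 Γ d)).continuous
  have hg : Continuous fun x : WithLp 2 (StripL2 Γ d × StripGradL2 Γ d) => x.snd :=
    (WithLp.sndL 2 ℂ (StripL2 Γ d) (StripGradL2 Γ d)).continuous
  have hg1 : Continuous fun x : WithLp 2 (StripL2 Γ d × StripGradL2 Γ d) => x.snd.fst :=
    (WithLp.fstL 2 ℂ (Lp ℂ 2 (stripInvMeasure Γ d)) (StripL2 Γ d)).continuous.comp hg
  have hg2 : Continuous fun x : WithLp 2 (StripL2 Γ d × StripGradL2 Γ d) => x.snd.snd :=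
    (WithLp.sndL 2 ℂ (Lp ℂ 2 (stripInvMeasure Γ d)) (StripL2 Γ d)).continuous.comp hg
  change IsClosed {x | _ ∧ _}
  refine IsClosed.and ?_ ?_
  · simp only [ofPred_forall]
    refine isClosed_iInter fun φ => isClosed_iInter fun hφ => isClosed_iInter fun hc =>
      isClosed_iInter fun _ => ?_
    obtain ⟨ℓ, hℓ⟩ := hs.isStripWeight.exists_testPairing
        (continuous_fderiv_apply_const hφ (1, 0)) (hc.fderiv_apply_const _)
    obtain ⟨m, hm⟩ := hs.isStripWeight_inv.exists_testPairing hφ.continuous hc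
    simp only [← hℓ, ← hm]
    exact isClosed_eq (ℓ.continuous.comp hf) (m.continuous.comp hg1).neg
  · simp only [ofPred_forall]
    refine isClosed_iInter fun φ => isClosed_iInter fun hφ => isClosed_iInter fun hc =>
      isClosed_iInter fun _ => ?_
    obtain ⟨ℓ, hℓ⟩ := hs.isStripWeight.exists_testPairing
        (continuous_fderiv_apply_const hφ (0, 1)) (hc.fderiv_apply_const _)
    obtain ⟨m, hm⟩ := hs.isStripWeight.exists_testPairing hφ.continuous hc
    simp only [← hℓ, ← hm]
    exact isClosed_eq (ℓ.continuous.comp hf) (m.continuous.comp hg2).neg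

theorem hasWeakDeriv_of_memLp {U : Set (ℝ × ℝ)} {v : ℝ × ℝ} {f g : ℝ × ℝ → ℂ}
    (hf : MemLp f 2 (volume.restrict U)) (hg : MemLp g 2 (volume.restrict U))
    (h : ∀ φ : ℝ × ℝ → ℝ, ContDiff ℝ ∞ φ → HasCompactSupport φ → tsupport φ ⊆ U →
      ∫ p in U, fderiv ℝ φ p v • f p = -∫ p in U, φ p • g p) : HasWeakDeriv U v f g where
  locInt_fun :=
    locallyIntegrableOn_of_locallyIntegrable_restrict (hf.locallyIntegrable (by norm_num))
  locInt_deriv :=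
    locallyIntegrableOn_of_locallyIntegrable_restrict (hg.locallyIntegrable (by norm_num))
  integral_eq := h

/-- The test functions of the second condition include those supported in the strip, so both
components are weak derivatives. Their uniqueness identifies them with the chosen `weakDeriv`. -/
theorem mem_formGraph_iff (hs : IsCurvedStrip Γ d) {f : StripL2 Γ d} {y : StripGradL2 Γ d} :
    WithLp.toLp 2 (f, y) ∈ formGraph hs ↔ MemFormDomain Γ d f ∧
      y.fst =ᵐ[volume.restrict (straightStrip d)] weakDeriv (straightStrip d) (1, 0) f ∧
      y.snd =ᵐ[volume.restrict (straightStrip d)] weakDeriv (straightStrip d) (0, 1) f := by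
  have hU := isOpen_straightStrip d
  rw [memFormDomain_iff]
  constructor
  · rintro ⟨h1, h2⟩
    simp only [WithLp.toLp_fst, WithLp.toLp_snd] at h1 h2
    have hf := hs.isStripWeight.memLp_iff.mp (Lp.memLp f)
    have ha := hs.isStripWeight_inv.memLp_iff.mp (Lp.memLp y.fst)
    have hb := hs.isStripWeight.memLp_iff.mp (Lp.memLp y.snd)
    have hwa := hasWeakDeriv_of_memLp hf ha h1
    have hwb := hasWeakDeriv_of_memLp hf hb fun φ hφ hc hsupp =>
      h2 φ hφ hc fun p hp => (hsupp hp).2.2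
    have hla : HasL2WeakDeriv (straightStrip d) (1, 0) f := ⟨_, hwa, ha⟩
    have hlb : HasL2WeakDeriv (straightStrip d) (0, 1) f := ⟨_, hwb, hb⟩
    have ea := hwa.ae_eq hU hla.hasWeakDeriv
    have eb := hwb.ae_eq hU hlb.hasWeakDeriv
    refine ⟨⟨⟨hf, hla, hlb⟩, fun φ hφ hc hsupp => ?_⟩, ea, eb⟩
    rw [h2 φ hφ hc hsupp]
    congr 1
    apply integral_congr_ae
    filter_upwards [eb] with p hp
    rw [hp]
  · rintro ⟨⟨hf, hg⟩, ea, eb⟩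
    constructor <;> intro φ hφ hc hsupp <;> simp only [WithLp.toLp_fst, WithLp.toLp_snd]
    · rw [hf.deriv_s.hasWeakDeriv.integral_eq φ hφ hc hsupp]
      congr 1
      apply integral_congr_ae
      filter_upwards [ea] with p hp
      rw [hp]
    · rw [hg φ hφ hc hsupp]
      congr 1
      apply integral_congr_ae
      filter_upwards [eb] with p hp
      rw [hp]

theorem MemFormDomain.exists_mem_formGraph (hs : IsCurvedStrip Γ d) {f : StripL2 Γ d}
    (hf : MemFormDomain Γ d f) : ∃ y, WithLp.toLp 2 (f, y) ∈ formGraph hs := by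
  have hU := isOpen_straightStrip d
  have ha := hs.isStripWeight_inv.memLp_iff.mpr (hf.memH1.deriv_s.memLp hU)
  have hb := hs.isStripWeight.memLp_iff.mpr (hf.memH1.deriv_u.memLp hU)
  refine ⟨WithLp.toLp 2 (ha.toLp _, hb.toLp _), (mem_formGraph_iff hs).mpr ⟨hf, ?_, ?_⟩⟩
  · have := ha.coeFn_toLp
    rwa [Filter.EventuallyEq, hs.isStripWeight_inv.ae_eq] at this
  · have := hb.coeFn_toLp
    rwa [Filter.EventuallyEq, hs.isStripWeight.ae_eq] at this

/-- The weights of the two factors of `StripGradL2` are exactly the coefficients of the form, whence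
q₀(f, g) = ⟨Df, Dg⟩. -/
theorem inner_snd_eq_stripForm (hs : IsCurvedStrip Γ d) {f g : StripL2 Γ d}
    {y z : StripGradL2 Γ d} (hf : WithLp.toLp 2 (f, y) ∈ formGraph hs)
    (hg : WithLp.toLp 2 (g, z) ∈ formGraph hs) : inner ℂ y z = stripForm Γ d f g := by
  obtain ⟨-, fa, fb⟩ := (mem_formGraph_iff hs).mp hf
  obtain ⟨-, ga, gb⟩ := (mem_formGraph_iff hs).mp hg
  rw [WithLp.prod_inner_apply]
  simp only [WithLp.ofLp_fst, WithLp.ofLp_snd]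
  rw [hs.isStripWeight_inv.inner_eq, hs.isStripWeight.inner_eq,
    ← integral_add (hs.isStripWeight_inv.integrable_inner _ _)
      (hs.isStripWeight.integrable_inner _ _), stripForm]
  apply integral_congr_ae
  filter_upwards [fa, fb, ga, gb] with p h1 h2 h3 h4
  rw [stripFormIntegrand, h1, h2, h3, h4]

instance (hs : IsCurvedStrip Γ d) : (formGraph hs).HasOrthogonalProjection :=
  have : CompleteSpace (formGraph hs) := (isClosed_formGraph hs).completeSpace_coe
  inferInstance

/-- Adding ⟨g, f⟩ to both sides of q₀(g, f) = ⟨g, h⟩ gives the weak equation that characterizes T(f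
+ h) in `eq_formResolvent_iff`. -/
theorem mem_graph_iff_formResolvent (hs : IsCurvedStrip Γ d) (f h : StripL2 Γ d) :
    (f, h) ∈ (dirichletNeumannLaplacian hs).graph ↔ f = formResolvent (formGraph hs) (f + h) := by
  rw [graph_dirichletNeumannLaplacian, eq_formResolvent_iff]
  constructor
  · rintro ⟨hf, hq⟩
    obtain ⟨y, hy⟩ := MemFormDomain.exists_mem_formGraph hs hf
    refine ⟨y, hy, fun x hx => ?_⟩
    have h1 : inner ℂ x.snd y = stripForm Γ d x.fst f := inner_snd_eq_stripForm hs hx hy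
    have h2 : stripForm Γ d x.fst f = inner ℂ x.fst h :=
      hq _ ((mem_formGraph_iff hs (f := x.fst) (y := x.snd)).mp hx).1
    rw [WithLp.prod_inner_apply, inner_add_right, ← h2, ← h1]
    rfl
  · rintro ⟨y, hy, hx⟩
    refine ⟨((mem_formGraph_iff hs).mp hy).1, fun g hg => ?_⟩
    obtain ⟨z, hz⟩ := MemFormDomain.exists_mem_formGraph hs hg
    have h1 := hx _ hz
    rw [WithLp.prod_inner_apply] at h1
    simp only [WithLp.toLp_fst, inner_add_right] at h1
    exact (inner_snd_eq_stripForm hs hz hy).symm.trans (add_left_cancel h1).symm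

/-- If Th = 0, then (0, h) lies in the graph of the Laplacian, which is single-valued because the
form domain is dense. -/
theorem injective_formResolvent (hs : IsCurvedStrip Γ d) :
    Function.Injective (formResolvent (formGraph hs)) := by
  rw [injective_iff_map_eq_zero]
  intro h hh
  refine laplacianGraph_single_valued hs (0, h) ?_ rfl
  rw [← graph_dirichletNeumannLaplacian, mem_graph_iff_formResolvent, zero_add, hh]

theorem isSelfAdjoint_dirichletNeumannLaplacian (hs : IsCurvedStrip Γ d) :
    IsSelfAdjoint (dirichletNeumannLaplacian hs) :=
  LinearPMap.isSelfAdjoint_of_graph (formResolvent_nonneg _).isSelfAdjoint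
    (injective_formResolvent hs) (mem_graph_iff_formResolvent hs)

theorem bddBelow_realSpectrum (hs : IsCurvedStrip Γ d) :
    BddBelow (dirichletNeumannLaplacian hs).realSpectrum :=
  ⟨-1, fun _ hx => LinearPMap.neg_one_le_of_mem_realSpectrum (formResolvent_nonneg _)
    (mem_graph_iff_formResolvent hs) hx⟩

/-- The variational upper bound for the bottom of the spectrum. -/
theorem exists_mem_realSpectrum_lt_of_stripForm_lt (hs : IsCurvedStrip Γ d) {f : StripL2 Γ d}
    (hf : MemFormDomain Γ d f) {c : ℝ} (hlt : (stripForm Γ d f f).re < c * ‖f‖ ^ 2) :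
    ∃ x ∈ (dirichletNeumannLaplacian hs).realSpectrum, x < c := by
  obtain ⟨y, hy⟩ := MemFormDomain.exists_mem_formGraph hs hf
  refine exists_mem_realSpectrum_lt (formGraph hs) (injective_formResolvent hs)
    (mem_graph_iff_formResolvent hs) hy ?_
  rwa [← inner_snd_eq_stripForm hs hy hy, ← RCLike.re_eq_complex_re,
    ← norm_sq_eq_re_inner] at hlt

end FormGraph

/-! ### Product functions and integration by parts on the strip -/

theorem volume_restrict_straightStrip (d : ℝ) :
    (volume : Measure (ℝ × ℝ)).restrict (straightStrip d) =
      (volume : Measure ℝ).prod (volume.restrict (Ioo 0 d)) := by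
  rw [straightStrip, Measure.volume_eq_prod, ← Measure.prod_restrict, Measure.restrict_univ]

theorem integrable_mul_straightStrip {d : ℝ} {f g : ℝ → ℝ} (hf : Integrable f)
    (hg : Continuous g) :
    Integrable (fun p : ℝ × ℝ => f p.1 * g p.2) (volume.restrict (straightStrip d)) := by
  rw [volume_restrict_straightStrip]
  exact hf.mul_prod ((hg.integrableOn_Icc (a := 0) (b := d)).mono_set Ioo_subset_Icc_self)

theorem integral_mul_straightStrip {d : ℝ} (hd : 0 ≤ d) (f g : ℝ → ℝ) :
    ∫ p in straightStrip d, f p.1 * g p.2 = (∫ s, f s) * ∫ u in (0)..d, g u := by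
  rw [volume_restrict_straightStrip, integral_prod_mul, intervalIntegral.integral_of_le hd,
    integral_Ioc_eq_integral_Ioo]

theorem integrable_sq_of_hasCompactSupport {φ : ℝ → ℝ} (hφ : Continuous φ)
    (hc : HasCompactSupport φ) : Integrable fun s => φ s ^ 2 := by
  simp only [sq]
  exact (hφ.mul hφ).integrable_of_hasCompactSupport hc.mul_left

theorem memLp_mul_straightStrip {d : ℝ} {φ χ : ℝ → ℝ} (hφ : Continuous φ)
    (hc : HasCompactSupport φ) (hχ : Continuous χ) :
    MemLp (fun p : ℝ × ℝ => ((φ p.1 * χ p.2 : ℝ) : ℂ)) 2 (volume.restrict (straightStrip d)) := by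
  have h : MemLp (fun p : ℝ × ℝ => φ p.1 * χ p.2) 2 (volume.restrict (straightStrip d)) := by
    rw [memLp_two_iff_integrable_sq (by fun_prop)]
    have h2 := integrable_sq_of_hasCompactSupport hφ hc
    simp only [mul_pow]
    exact integrable_mul_straightStrip (f := fun s => φ s ^ 2) (g := fun u => χ u ^ 2) h2 (hχ.pow 2)
  exact h.ofReal

theorem hasFDerivAt_mul_fst_snd {φ χ : ℝ → ℝ} (hφ : Differentiable ℝ φ)
    (hχ : Differentiable ℝ χ) (p : ℝ × ℝ) :
    HasFDerivAt (fun p : ℝ × ℝ => φ p.1 * χ p.2)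
      (φ p.1 • (deriv χ p.2 • ContinuousLinearMap.snd ℝ ℝ ℝ) +
        χ p.2 • (deriv φ p.1 • ContinuousLinearMap.fst ℝ ℝ ℝ)) p := by
  have h1 := ((hφ p.1).hasDerivAt).comp_hasFDerivAt p
    (ContinuousLinearMap.fst ℝ ℝ ℝ).hasFDerivAt
  have h2 := ((hχ p.2).hasDerivAt).comp_hasFDerivAt p
    (ContinuousLinearMap.snd ℝ ℝ ℝ).hasFDerivAt
  exact h1.mul h2

/-- Integration by parts in the direction of the strip. -/
theorem integral_fderiv_fst_mul_eq {d : ℝ} {φ χ : ℝ → ℝ} (hφ : ContDiff ℝ 1 φ)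
    (hχ : ContDiff ℝ 1 χ) {ψ : ℝ × ℝ → ℝ} (hψ : ContDiff ℝ ∞ ψ) (hψc : HasCompactSupport ψ)
    (hsupp : tsupport ψ ⊆ straightStrip d) :
    ∫ p in straightStrip d, fderiv ℝ ψ p (1, 0) * (φ p.1 * χ p.2) =
      -∫ p in straightStrip d, ψ p * (deriv φ p.1 * χ p.2) := by
  have hφd := hφ.differentiable one_ne_zero
  have hχd := hχ.differentiable one_ne_zero
  have hφ' : Continuous (deriv φ) := hφ.continuous_deriv le_rfl
  have hψ0 : ∀ p ∉ straightStrip d, ψ p = 0 := fun p hp => by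
    by_contra h0
    exact hp (hsupp (subset_tsupport _ h0))
  have hD0 : ∀ p ∉ straightStrip d, fderiv ℝ ψ p (1, 0) = 0 := fun p hp => by
    by_contra h0
    exact hp (hsupp (tsupport_fderiv_apply_subset' ψ _ (subset_tsupport _ h0)))
  have hD := continuous_fderiv_apply_const hψ (1, 0)
  have hDc := hψc.fderiv_apply_const (1, 0)
  have hF : ∀ p : ℝ × ℝ, fderiv ℝ (fun p : ℝ × ℝ => φ p.1 * χ p.2) p (1, 0) =
      deriv φ p.1 * χ p.2 := fun p => by
    rw [(hasFDerivAt_mul_fst_snd hφd hχd p).fderiv]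
    simp [mul_comm]
  have hFc : Continuous fun p : ℝ × ℝ => φ p.1 * χ p.2 := by
    have := hφ.continuous
    have := hχ.continuous
    fun_prop
  have hF'c : Continuous fun p : ℝ × ℝ => deriv φ p.1 * χ p.2 := by
    have := hχ.continuous
    fun_prop
  -- Since ψ vanishes off the strip, the integration by parts takes place on the whole plane, and
  -- its compact support gives integrability.
  have h := integral_mul_fderiv_eq_neg_fderiv_mul_of_integrable (μ := (volume : Measure (ℝ × ℝ)))
    (f := fun p : ℝ × ℝ => φ p.1 * χ p.2) (g := ψ) (v := (1, 0))
    (by simp only [hF]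
        exact (hF'c.mul hψ.continuous).integrable_of_hasCompactSupport hψc.mul_left)
    ((hFc.mul hD).integrable_of_hasCompactSupport hDc.mul_left)
    ((hFc.mul hψ.continuous).integrable_of_hasCompactSupport hψc.mul_left)
    (fun p _ => (hasFDerivAt_mul_fst_snd hφd hχd p).differentiableAt)
    (fun p _ => (hψ.differentiable (by simp)) p)
  simp only [hF] at h
  rw [setIntegral_eq_integral_of_forall_compl_eq_zero (fun p hp => by simp [hD0 p hp]),
    setIntegral_eq_integral_of_forall_compl_eq_zero (fun p hp => by simp [hψ0 p hp])]
  simpa only [mul_comm (ψ _), mul_comm (fderiv ℝ ψ _ _)] using h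

/-- Integration by parts across the strip. -/
theorem integral_fderiv_snd_mul_eq {d : ℝ} (hd : 0 ≤ d) {φ χ : ℝ → ℝ} (hφ : Continuous φ)
    (hχ : ContDiff ℝ 1 χ) (hχ0 : χ 0 = 0) {ψ : ℝ × ℝ → ℝ} (hψ : ContDiff ℝ ∞ ψ)
    (hψc : HasCompactSupport ψ) (hsupp : tsupport ψ ⊆ {p | p.2 < d}) :
    ∫ p in straightStrip d, fderiv ℝ ψ p (0, 1) * (φ p.1 * χ p.2) =
      -∫ p in straightStrip d, ψ p * (φ p.1 * deriv χ p.2) := by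
  have hχd := hχ.differentiable one_ne_zero
  have hχc := hχ.continuous
  have hχ' : Continuous (deriv χ) := hχ.continuous_deriv le_rfl
  have hD := continuous_fderiv_apply_const hψ (0, 1)
  have hDc := hψc.fderiv_apply_const (0, 1)
  have hi1 : Integrable (fun p : ℝ × ℝ => fderiv ℝ ψ p (0, 1) * (φ p.1 * χ p.2)) :=
    (hD.mul (by fun_prop)).integrable_of_hasCompactSupport hDc.mul_right
  have hi2 : Integrable (fun p : ℝ × ℝ => ψ p * (φ p.1 * deriv χ p.2)) :=
    (hψ.continuous.mul (by fun_prop)).integrable_of_hasCompactSupport hψc.mul_right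
  rw [straightStrip, Measure.volume_eq_prod, setIntegral_prod _ hi1.integrableOn,
    setIntegral_prod _ hi2.integrableOn, ← integral_neg]
  congr 1
  ext s
  have hline : ∀ u, HasDerivAt (fun u => ψ (s, u)) (fderiv ℝ ψ (s, u) (0, 1)) u := fun u => by
    have h1 := (hψ.differentiable (by simp) (s, u)).hasFDerivAt
    exact h1.comp_hasDerivAt u ((hasDerivAt_const u s).prodMk (hasDerivAt_id u))
  have hDs : Continuous fun u => fderiv ℝ ψ (s, u) (0, 1) := hD.comp (by fun_prop)
  -- Both boundary terms vanish: at u = d because of the support of ψ, at u = 0 because χ does.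
  have hψd : ψ (s, d) = 0 := by
    by_contra h0
    exact lt_irrefl d (hsupp (subset_tsupport _ h0))
  have h := intervalIntegral.integral_mul_deriv_eq_deriv_mul (a := 0) (b := d)
    (u := fun u => φ s * χ u) (u' := fun u => φ s * deriv χ u)
    (fun u _ => (hχd u).hasDerivAt.const_mul (φ s)) (fun u _ => hline u)
    (Continuous.intervalIntegrable (by fun_prop) _ _) (hDs.intervalIntegrable _ _)
  rw [hψd, hχ0] at h
  rw [intervalIntegral.integral_of_le hd, intervalIntegral.integral_of_le hd,
    integral_Ioc_eq_integral_Ioo, integral_Ioc_eq_integral_Ioo] at h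
  simp only [mul_comm (ψ _), mul_comm (fderiv ℝ ψ _ _)]
  simpa using h

/-! ### The trial function and its energy -/

section Trial

variable {Γ : ℝ → EuclideanSpace ℝ (Fin 2)} {d : ℝ}

/-- Products of functions of `s` and of `u` are in the form domain. -/
theorem exists_memFormDomain_mul (hs : IsCurvedStrip Γ d) {φ χ : ℝ → ℝ} (hφ : ContDiff ℝ 1 φ)
    (hc : HasCompactSupport φ) (hχ : ContDiff ℝ 1 χ) (hχ0 : χ 0 = 0) :
    ∃ f : StripL2 Γ d, MemFormDomain Γ d f ∧
      f =ᵐ[volume.restrict (straightStrip d)] (fun p => ((φ p.1 * χ p.2 : ℝ) : ℂ)) ∧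
      weakDeriv (straightStrip d) (1, 0) f =ᵐ[volume.restrict (straightStrip d)]
        (fun p => ((deriv φ p.1 * χ p.2 : ℝ) : ℂ)) ∧
      weakDeriv (straightStrip d) (0, 1) f =ᵐ[volume.restrict (straightStrip d)]
        (fun p => ((φ p.1 * deriv χ p.2 : ℝ) : ℂ)) := by
  have hF := hs.isStripWeight.memLp_iff.mpr
    (memLp_mul_straightStrip hφ.continuous hc hχ.continuous)
  have hA := hs.isStripWeight_inv.memLp_iff.mpr
    (memLp_mul_straightStrip (hφ.continuous_deriv le_rfl) hc.deriv hχ.continuous)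
  have hB := hs.isStripWeight.memLp_iff.mpr
    (memLp_mul_straightStrip hφ.continuous hc (hχ.continuous_deriv le_rfl))
  have eF := hF.coeFn_toLp
  have eA := hA.coeFn_toLp
  have eB := hB.coeFn_toLp
  rw [Filter.EventuallyEq, hs.isStripWeight.ae_eq] at eF eB
  rw [Filter.EventuallyEq, hs.isStripWeight_inv.ae_eq] at eA
  -- Membership in the graph is tested with the classical derivatives; `mem_formGraph_iff` then
  -- yields both the form domain and the values of `weakDeriv`.
  have hmem : WithLp.toLp 2 (hF.toLp _, WithLp.toLp 2 (hA.toLp _, hB.toLp _)) ∈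
      formGraph hs := by
    have hcast : ∀ {a b g k : ℝ × ℝ → ℝ} {f h : ℝ × ℝ → ℂ},
        (∀ᵐ p ∂(volume.restrict (straightStrip d)), f p = (g p : ℂ)) →
        (∀ᵐ p ∂(volume.restrict (straightStrip d)), h p = (k p : ℂ)) →
        ∫ p in straightStrip d, a p * g p = -∫ p in straightStrip d, b p * k p →
        ∫ p in straightStrip d, a p • f p = -∫ p in straightStrip d, b p • h p := by
      intro a b g k f h hf hh hint
      have e1 : ∫ p in straightStrip d, a p • f p =
          ((∫ p in straightStrip d, a p * g p : ℝ) : ℂ) := by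
        rw [← integral_complex_ofReal]
        apply integral_congr_ae
        filter_upwards [hf] with p hp
        rw [hp, Complex.real_smul, Complex.ofReal_mul]
      have e2 : ∫ p in straightStrip d, b p • h p =
          ((∫ p in straightStrip d, b p * k p : ℝ) : ℂ) := by
        rw [← integral_complex_ofReal]
        apply integral_congr_ae
        filter_upwards [hh] with p hp
        rw [hp, Complex.real_smul, Complex.ofReal_mul]
      rw [e1, e2, hint, Complex.ofReal_neg]
    exact ⟨fun ψ hψ hψc hsupp => hcast eF eA (integral_fderiv_fst_mul_eq hφ hχ hψ hψc hsupp),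
      fun ψ hψ hψc hsupp => hcast eF eB
        (integral_fderiv_snd_mul_eq hs.d_pos.le hφ.continuous hχ hχ0 hψ hψc hsupp)⟩
  obtain ⟨h1, h2, h3⟩ := (mem_formGraph_iff hs).mp hmem
  exact ⟨_, h1, eF, h2.symm.trans eA, h3.symm.trans eB⟩

/-- Smooth cutoff functions with small Dirichlet energy. -/
theorem exists_cutoff (R : ℝ) {ε : ℝ} (hε : 0 < ε) :
    ∃ φ : ℝ → ℝ, ContDiff ℝ 1 φ ∧ HasCompactSupport φ ∧ (∀ s, |s| ≤ R → φ s = 1) ∧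
      ∫ s, deriv φ s ^ 2 < ε := by
  let b : ContDiffBump (0 : ℝ) := ⟨1, 2, one_pos, one_lt_two⟩
  set I := ∫ s, deriv b s ^ 2 with hI
  have hI0 : 0 ≤ I := integral_nonneg fun s => sq_nonneg _
  -- Stretching the bump by n divides its Dirichlet energy I by n. Thus n > I/ε makes the energy
  -- small, and n ≥ R makes the plateau [-n, n] long enough.
  set n : ℝ := max R 0 + I / ε + 1 with hn
  have hIε : 0 ≤ I / ε := by positivity
  have hn0 : 0 < n := by positivity
  have hR : R ≤ n := by linarith [le_max_left R 0]
  have hbd : Differentiable ℝ b := b.contDiff.differentiable (n := 1) one_ne_zero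
  refine ⟨fun s => b (s / n), b.contDiff.comp (contDiff_id.div_const n), ?_, fun s hsR => ?_, ?_⟩
  · have h := b.hasCompactSupport.comp_homeomorph (Homeomorph.mulRight₀ n⁻¹ (by positivity))
    simpa [Function.comp_def, div_eq_mul_inv] using h
  · apply b.one_of_mem_closedBall
    rw [mem_closedBall_zero_iff, Real.norm_eq_abs, abs_div, abs_of_pos hn0]
    exact (div_le_one hn0).mpr (hsR.trans hR)
  · have hder : ∀ s, deriv (fun s => b (s / n)) s = deriv b (s / n) / n := fun s => by
      have h1 := ((hbd (s / n)).hasDerivAt).comp s ((hasDerivAt_id s).div_const n)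
      rw [show (fun s => b (s / n)) = b ∘ fun s => id s / n from rfl, h1.deriv]
      simp [div_eq_mul_inv]
    simp only [hder, div_pow]
    rw [integral_div, Measure.integral_comp_div (fun s => deriv b s ^ 2) n, smul_eq_mul,
      abs_of_pos hn0, ← hI]
    rw [div_lt_iff₀ (by positivity)]
    have : I / ε < n := by linarith [le_max_right R 0]
    rw [div_lt_iff₀ hε] at this
    nlinarith

theorem integral_cos_transverse (hd : 0 < d) :
    ∫ u in (0)..d, Real.cos (Real.pi / d * u) = 0 := by
  have hk : Real.pi / d ≠ 0 := by positivity
  rw [intervalIntegral.integral_comp_mul_left (fun x => Real.cos x) hk, integral_cos]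
  rw [div_mul_cancel₀ _ hd.ne']
  simp

/-- The antiderivative comes from integration by parts. The value is negative because the factor u
favours the half of (0, d) where the cosine is negative; this sign makes negative curvature lower
the energy. -/
theorem integral_mul_cos_transverse (hd : 0 < d) :
    ∫ u in (0)..d, u * Real.cos (Real.pi / d * u) = -2 * (d / Real.pi) ^ 2 := by
  have hpi := Real.pi_pos
  have hder : ∀ u ∈ uIcc 0 d, HasDerivAt (fun u => d / Real.pi * (u * Real.sin (Real.pi / d * u)) +
      (d / Real.pi) ^ 2 * Real.cos (Real.pi / d * u)) (u * Real.cos (Real.pi / d * u)) u := by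
    intro u _
    have h0 : HasDerivAt (fun u => Real.pi / d * u) (Real.pi / d) u := by
      simpa using (hasDerivAt_id u).const_mul (Real.pi / d)
    have h1 := (((hasDerivAt_id u).mul h0.sin).const_mul (d / Real.pi)).add
      (h0.cos.const_mul ((d / Real.pi) ^ 2))
    refine h1.congr_deriv ?_
    simp only [id]
    field_simp
    ring
  rw [intervalIntegral.integral_eq_sub_of_hasDerivAt hder
    (Continuous.intervalIntegrable (by fun_prop) _ _), div_mul_cancel₀ _ hd.ne']
  simp
  ring

theorem exists_abs_signedCurvature_le (hs : IsCurvedStrip Γ d) :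
    ∃ C, ∀ s, |signedCurvature Γ s| ≤ C := by
  obtain ⟨γm, γp, -, -, -, hb⟩ := hs.curvature_bounds
  exact ⟨max γm γp, fun s => abs_le.mpr ⟨by linarith [(hb s).1, le_max_left γm γp],
    (hb s).2.trans (le_max_right _ _)⟩⟩

theorem integrable_mul_signedCurvature (hs : IsCurvedStrip Γ d) {φ : ℝ → ℝ}
    (hφ : Integrable φ) : Integrable (fun s => φ s * signedCurvature Γ s) := by
  obtain ⟨C, hC⟩ := exists_abs_signedCurvature_le hs
  exact hφ.mul_bdd (c := C) (measurable_signedCurvature Γ).aestronglyMeasurable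
    (Filter.Eventually.of_forall hC)

/-- Since the transverse mode is the ground state of the straight strip, only the curvature
contributes to the transverse energy. -/
theorem integral_jacobian_transverse (hs : IsCurvedStrip Γ d) {φ : ℝ → ℝ}
    (hφ : Integrable fun s => φ s ^ 2) :
    ∫ p in straightStrip d, stripJacobian Γ p *
      (φ p.1 ^ 2 * (Real.pi ^ 2 / (4 * d ^ 2) * Real.cos (Real.pi / d * p.2))) =
      (∫ s, φ s ^ 2 * signedCurvature Γ s) / 2 := by
  have hd := hs.d_pos
  have hpi := Real.pi_pos
  have hγ := integrable_mul_signedCurvature hs hφ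
  have e : ∀ p : ℝ × ℝ, stripJacobian Γ p *
      (φ p.1 ^ 2 * (Real.pi ^ 2 / (4 * d ^ 2) * Real.cos (Real.pi / d * p.2))) =
      Real.pi ^ 2 / (4 * d ^ 2) * (φ p.1 ^ 2 * Real.cos (Real.pi / d * p.2)) -
      Real.pi ^ 2 / (4 * d ^ 2) * ((φ p.1 ^ 2 * signedCurvature Γ p.1) *
        (p.2 * Real.cos (Real.pi / d * p.2))) := fun p => by
    rw [stripJacobian]
    ring
  simp only [e]
  -- By Fubini the curvature-free term contains the vanishing cosine integral; the other has the
  -- coefficient -(π²/(4d²)) · (-2d²/π²) = 1/2.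
  rw [integral_sub, integral_const_mul, integral_const_mul,
    integral_mul_straightStrip hd.le (fun s => φ s ^ 2) (fun u => Real.cos (Real.pi / d * u)),
    integral_mul_straightStrip hd.le (fun s => φ s ^ 2 * signedCurvature Γ s)
      (fun u => u * Real.cos (Real.pi / d * u)),
    integral_cos_transverse hd, integral_mul_cos_transverse hd]
  · field_simp
    ring
  · exact (integrable_mul_straightStrip (f := fun s => φ s ^ 2)
      (g := fun u => Real.cos (Real.pi / d * u)) hφ (by fun_prop)).const_mul _
  · exact (integrable_mul_straightStrip (f := fun s => φ s ^ 2 * signedCurvature Γ s)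
      (g := fun u => u * Real.cos (Real.pi / d * u)) hγ (by fun_prop)).const_mul _

/-- Where the cutoff is not known to be 1 the curvature is nonpositive, so that part of the integral
can be dropped. The cutoff supplies integrability, and γ need not be integrable on the line. -/
theorem integral_cutoff_mul_signedCurvature_le (hs : IsCurvedStrip Γ d) {s₀ : ℝ} (hs₀ : 0 < s₀)
    (hγ : ∀ s : ℝ, s₀ ≤ |s| → signedCurvature Γ s ≤ 0) {φ : ℝ → ℝ}
    (hφ : Integrable fun s => φ s ^ 2) (hφ1 : ∀ s, |s| ≤ s₀ → φ s = 1) :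
    ∫ s, φ s ^ 2 * signedCurvature Γ s ≤ ∫ s in (-s₀)..s₀, signedCurvature Γ s := by
  rw [intervalIntegral.integral_of_le (by linarith), ← integral_indicator measurableSet_Ioc]
  have hint : Integrable ((Ioc (-s₀) s₀).indicator (signedCurvature Γ)) := by
    obtain ⟨C, hC⟩ := exists_abs_signedCurvature_le hs
    rw [integrable_indicator_iff measurableSet_Ioc]
    exact Measure.integrableOn_of_bounded (M := C) (by simp)
      (measurable_signedCurvature Γ).aestronglyMeasurable (Filter.Eventually.of_forall hC)
  refine integral_mono (integrable_mul_signedCurvature hs hφ) hint fun s => ?_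
  by_cases h : s ∈ Ioc (-s₀) s₀
  · simp only [indicator_of_mem h]
    rw [hφ1 s (abs_le.mpr ⟨h.1.le, h.2⟩)]
    simp
  · simp only [indicator_of_notMem h]
    refine mul_nonpos_of_nonneg_of_nonpos (sq_nonneg _) (hγ s ?_)
    by_contra! h'
    exact h ⟨(abs_lt.mp h').1, (abs_lt.mp h').2.le⟩

theorem integrable_bdd_mul_straightStrip {w : ℝ × ℝ → ℝ} {μ : Measure (ℝ × ℝ)}
    (hw : IsStripWeight d w μ) {g : ℝ × ℝ → ℝ}
    (hg : Integrable g (volume.restrict (straightStrip d))) :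
    Integrable (fun p => w p * g p) (volume.restrict (straightStrip d)) := by
  obtain ⟨a, b, ha, hab⟩ := hw.bounds
  refine hg.bdd_mul (c := b) hw.measurable.aestronglyMeasurable ?_
  rw [ae_restrict_iff' (isOpen_straightStrip d).measurableSet]
  refine Filter.Eventually.of_forall fun p hp => ?_
  rw [Real.norm_of_nonneg (hw.pos hp).le]
  exact (hab p hp).2

theorem integrable_weight_mul_sq {w : ℝ × ℝ → ℝ} {μ : Measure (ℝ × ℝ)}
    (hw : IsStripWeight d w μ) {φ χ : ℝ → ℝ} (hφ : Continuous φ) (hc : HasCompactSupport φ)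
    (hχ : Continuous χ) :
    Integrable (fun p => w p * (φ p.1 ^ 2 * χ p.2 ^ 2)) (volume.restrict (straightStrip d)) := by
  have hφ2 := integrable_sq_of_hasCompactSupport hφ hc
  exact integrable_bdd_mul_straightStrip hw
    (integrable_mul_straightStrip (f := fun s => φ s ^ 2) (g := fun u => χ u ^ 2) hφ2 (hχ.pow 2))

theorem stripForm_self_re_of_ae_eq (hs : IsCurvedStrip Γ d) {f : StripL2 Γ d} {φ χ : ℝ → ℝ}
    (hφ : ContDiff ℝ 1 φ) (hc : HasCompactSupport φ) (hχ : ContDiff ℝ 1 χ)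
    (es : weakDeriv (straightStrip d) (1, 0) f =ᵐ[volume.restrict (straightStrip d)]
        (fun p => ((deriv φ p.1 * χ p.2 : ℝ) : ℂ)))
    (eu : weakDeriv (straightStrip d) (0, 1) f =ᵐ[volume.restrict (straightStrip d)]
        (fun p => ((φ p.1 * deriv χ p.2 : ℝ) : ℂ))) :
    (stripForm Γ d f f).re =
      (∫ p in straightStrip d, 1 / stripJacobian Γ p * (deriv φ p.1 ^ 2 * χ p.2 ^ 2)) +
        ∫ p in straightStrip d, stripJacobian Γ p * (φ p.1 ^ 2 * deriv χ p.2 ^ 2) := by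
  have i1 := integrable_weight_mul_sq hs.isStripWeight_inv (hφ.continuous_deriv le_rfl) hc.deriv
    hχ.continuous
  have i2 := integrable_weight_mul_sq hs.isStripWeight hφ.continuous hc
    (hχ.continuous_deriv le_rfl)
  have e : stripForm Γ d f f =
      ((∫ p in straightStrip d, (1 / stripJacobian Γ p * (deriv φ p.1 ^ 2 * χ p.2 ^ 2) +
        stripJacobian Γ p * (φ p.1 ^ 2 * deriv χ p.2 ^ 2)) : ℝ) : ℂ) := by
    rw [← integral_complex_ofReal, stripForm]
    apply integral_congr_ae
    filter_upwards [es, eu] with p h1 h2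
    rw [stripFormIntegrand, h1, h2, Complex.conj_ofReal, Complex.conj_ofReal]
    push_cast
    ring
  rw [e, Complex.ofReal_re, integral_add i1 i2]

theorem norm_sq_of_ae_eq (hs : IsCurvedStrip Γ d) {f : StripL2 Γ d} {φ χ : ℝ → ℝ}
    (ef : f =ᵐ[volume.restrict (straightStrip d)] (fun p => ((φ p.1 * χ p.2 : ℝ) : ℂ))) :
    ‖f‖ ^ 2 = ∫ p in straightStrip d, stripJacobian Γ p * (φ p.1 ^ 2 * χ p.2 ^ 2) := by
  have h1 := inner_self_eq_norm_sq_to_K (𝕜 := ℂ) f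
  rw [hs.isStripWeight.inner_eq] at h1
  apply Complex.ofReal_injective
  rw [← integral_complex_ofReal]
  refine Eq.trans (b := ((‖f‖ : ℂ)) ^ 2) (by push_cast; rfl) (h1.symm.trans ?_)
  apply integral_congr_ae
  filter_upwards [ef] with p h1
  rw [h1, Complex.conj_ofReal]
  push_cast
  ring

/-- The trial function: a longitudinal cutoff times the transverse ground state. -/
theorem exists_stripForm_lt (hs : IsCurvedStrip Γ d) {s₀ : ℝ} (hs₀ : 0 < s₀)
    (hγ : ∀ s : ℝ, s₀ ≤ |s| → signedCurvature Γ s ≤ 0)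
    (hbend : (∫ s in (-s₀)..s₀, signedCurvature Γ s) < 0) :
    ∃ f : StripL2 Γ d, MemFormDomain Γ d f ∧
      (stripForm Γ d f f).re < Real.pi ^ 2 / (4 * d ^ 2) * ‖f‖ ^ 2 := by
  have hd := hs.d_pos
  have hpi := Real.pi_pos
  obtain ⟨a, b, ha, hb, hab⟩ : ∃ a b : ℝ, 0 < a ∧ 0 < b ∧ ∀ p ∈ straightStrip d,
      a ≤ 1 / stripJacobian Γ p ∧ 1 / stripJacobian Γ p ≤ b := by
    obtain ⟨a, b, ha, hab⟩ := hs.isStripWeight_inv.bounds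
    have := hab (0, d / 2) ⟨mem_univ _, by simp; positivity, by simp; linarith⟩
    exact ⟨a, b, ha, by linarith, hab⟩
  set B := ∫ s in (-s₀)..s₀, signedCurvature Γ s with hB
  -- This ε makes the bound b d ∫ φ'² on the longitudinal energy less than -B/2, so that it cannot
  -- compensate the transverse gain.
  obtain ⟨φ, hφ, hc, hφ1, hφε⟩ := exists_cutoff s₀ (ε := -B / (2 * b * d))
    (div_pos (by linarith) (by positivity))
  -- With this k, sin(ku) vanishes at u = 0 and has zero derivative at u = d: it is the lowest
  -- Dirichlet–Neumann mode, with eigenvalue k² = π²/(4d²).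
  set k := Real.pi / (2 * d) with hk
  set χ : ℝ → ℝ := fun u => Real.sin (k * u) with hχdef
  have hχ' : deriv χ = fun u => k * Real.cos (k * u) := by
    ext u
    have h0 : HasDerivAt (fun u => k * u) k u := by
      simpa using (hasDerivAt_id u).const_mul k
    rw [h0.sin.deriv, mul_comm]
  have hχ : ContDiff ℝ 1 χ := Real.contDiff_sin.comp (contDiff_const.mul contDiff_id)
  obtain ⟨f, hf, ef, es, eu⟩ := exists_memFormDomain_mul hs hφ hc hχ (by simp [hχdef])
  refine ⟨f, hf, ?_⟩
  have hφ2 := integrable_sq_of_hasCompactSupport hφ.continuous hc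
  have hφ'2 := integrable_sq_of_hasCompactSupport (hφ.continuous_deriv le_rfl) hc.deriv
  have i1 := integrable_weight_mul_sq hs.isStripWeight_inv (hφ.continuous_deriv le_rfl) hc.deriv
    hχ.continuous
  have i2 := integrable_weight_mul_sq hs.isStripWeight hφ.continuous hc
    (hχ.continuous_deriv le_rfl)
  have i3 := integrable_weight_mul_sq hs.isStripWeight hφ.continuous hc hχ.continuous
  -- The integrands combine through k² cos²(ku) - k² sin²(ku) = k² cos(2ku), where 2k = π/d.
  have htrans : (∫ p in straightStrip d, stripJacobian Γ p * (φ p.1 ^ 2 * deriv χ p.2 ^ 2)) -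
      Real.pi ^ 2 / (4 * d ^ 2) *
        ∫ p in straightStrip d, stripJacobian Γ p * (φ p.1 ^ 2 * χ p.2 ^ 2) =
      (∫ s, φ s ^ 2 * signedCurvature Γ s) / 2 := by
    rw [← integral_jacobian_transverse hs hφ2, ← integral_const_mul,
      ← integral_sub i2 (i3.const_mul _)]
    congr 1
    ext p
    have h1 : Real.pi / d * p.2 = 2 * (k * p.2) := by rw [hk]; field_simp
    have h2 : Real.pi ^ 2 / (4 * d ^ 2) = k ^ 2 := by rw [hk]; field_simp; ring
    rw [h1, Real.cos_two_mul, hχ', h2]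
    simp only [hχdef, Real.sin_sq]
    ring
  have hlong : ∫ p in straightStrip d, 1 / stripJacobian Γ p * (deriv φ p.1 ^ 2 * χ p.2 ^ 2) ≤
      b * ((∫ s, deriv φ s ^ 2) * d) := by
    have h1 : ∫ p in straightStrip d, 1 / stripJacobian Γ p * (deriv φ p.1 ^ 2 * χ p.2 ^ 2) ≤
        ∫ p in straightStrip d, b * (deriv φ p.1 ^ 2 * 1) := by
      refine setIntegral_mono_on i1 ((integrable_mul_straightStrip
        (f := fun s => deriv φ s ^ 2) (g := fun _ => 1) hφ'2 continuous_const).const_mul b)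
        (isOpen_straightStrip d).measurableSet fun p hp => ?_
      have h2 : χ p.2 ^ 2 ≤ 1 := Real.sin_sq_le_one _
      have h3 := (hab p hp).2
      gcongr
    refine h1.trans_eq ?_
    rw [integral_const_mul, integral_mul_straightStrip hd.le (fun s => deriv φ s ^ 2)
      (fun _ => (1 : ℝ))]
    simp
  have hcurv := integral_cutoff_mul_signedCurvature_le hs hs₀ hγ hφ2 hφ1
  have hsmall : b * ((∫ s, deriv φ s ^ 2) * d) < -B / 2 := by
    rw [lt_div_iff₀ (by positivity)] at hφε
    linarith
  -- The form minus π²/(4d²) times the squared norm is at most b d ∫ φ'² + ½ ∫ φ²γ, which is less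
  -- than -B/2 + B/2 = 0.
  rw [stripForm_self_re_of_ae_eq hs hφ hc hχ es eu, norm_sq_of_ae_eq hs ef]
  linarith

end Trial

theorem mainTheorem1 (Γ : ℝ → EuclideanSpace ℝ (Fin 2)) (d : ℝ) (hs : IsCurvedStrip Γ d)
    (s₀ : ℝ) (hs₀ : 0 < s₀)
    (hγ : ∀ s : ℝ, s₀ ≤ |s| → signedCurvature Γ s ≤ 0)
    (hbend : (∫ s in (-s₀)..s₀, signedCurvature Γ s) < 0) :
    IsSelfAdjoint (dirichletNeumannLaplacian hs) ∧
    (dirichletNeumannLaplacian hs).realSpectrum.Nonempty ∧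
    BddBelow (dirichletNeumannLaplacian hs).realSpectrum ∧
    sInf (dirichletNeumannLaplacian hs).realSpectrum < Real.pi ^ 2 / (4 * d ^ 2) := by
  obtain ⟨f, hf, hlt⟩ := exists_stripForm_lt hs hs₀ hγ hbend
  obtain ⟨x, hx, hxlt⟩ := exists_mem_realSpectrum_lt_of_stripForm_lt hs hf hlt
  exact ⟨isSelfAdjoint_dirichletNeumannLaplacian hs, ⟨x, hx⟩, bddBelow_realSpectrum hs,
    (csInf_le (bddBelow_realSpectrum hs) hx).trans_lt hxlt⟩
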